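/- Theorem 3. Let $a\in[0,\pi/2)$ and let $\psi_1,\psi_2$ be even entire functions of exponential type $b_1,b_2$ respectively, i.e. for every $\delta>0$ there is a constant $C$ with $|\psi_j(z)|\le C e^{(b_j+\delta)|z|}$ for all $z\in\mathbb{C}$, where $0\le b_j<(1-\sin a)/(2e)$, $j=1,2$. For $\varepsilon>0$ and $x>0$ put $$f_\varepsilon(x,a)=\int_0^\infty e^{-\varepsilon\tau^2}\left[\psi_1(\tau)\cosh\left(\left(\tfrac{\pi}{2}+a\right)\tau\right)+\psi_2(\tau)\,\tau\sinh\left(\left(\tfrac{\pi}{2}+a\right)\tau\right)\right]K_{i\tau}(x)\,d\tau,$$ where $K_\nu(x)=\int_0^\infty e^{-x\cosh t}\cosh(\nu t)\,dt$ is Macdonald's function. For $\psi_j(z)=\sum_{n\ge0}c_{n,j}z^n$ and a smooth function $g$ of a real variable let $\psi_j(D_a)\{g\}=\sum_{n\ge0}c_{n,j}\,g^{(n)}(a)$, $D_a=d/da$ (here $c_{n,j}=0$ for odd $n$). Then: (i) the integral $f_\varepsilon(x,a)$ converges absolutely for all $\varepsilon>0$, $x>0$; (ii) for every $x>0$ the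 series $\psi_1(D_\alpha)\{e^{x\sin \alpha}\}$ and $\psi_2(D_\alpha)\{e^{x\sin \alpha}\}$ converge absolutely for all real $\alpha$, the function $\alpha\mapsto\psi_2(D_\alpha)\{e^{x\sin\alpha}\}$ is differentiable at $\alpha=a$, and its derivative there is the absolutely convergent series obtained by termwise differentiation, $D_a\psi_2(D_a)\{e^{x\sin a}\}=\sum_{n\ge0}c_{n,2}\frac{d^{n+1}}{da^{n+1}}e^{x\sin a}$; (iii) the limit $\lim_{\varepsilon\to0+}f_\varepsilon(x,a)$ has the value $$f(x,a)=\frac{\pi}{2}\left[\psi_1(D_a)+D_a\psi_2(D_a)\right]\left\{e^{x\sin a}\right\}$$ in the sense of the generalized Mellin transform, that is, for every $s\in\mathbb{C}$ with $\operatorname{Re}s>0$ the integrals below converge absolutely and $$\lim_{\varepsilon\to0+}\int_0^\infty f_\varepsilon(x,a)\,e^{-x}x^{s-1}\,dx=\int_0^\infty f(x,a)\,e^{-x}x^{s-1}\,dx .$$ -/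

import Mathlib

open Set Filter Topology MeasureTheory

noncomputable section

/-- Macdonald's function (modified Bessel function of the second kind)
`K_ν(x) = ∫₀^∞ exp(-x cosh t) cosh(ν t) dt`, for complex order `ν` and `x > 0`. -/
def macdonaldK (ν : ℂ) (x : ℝ) : ℂ :=
  ∫ t in Ioi (0 : ℝ), Complex.exp (-(x * Real.cosh t : ℝ)) * Complex.cosh (ν * t)

/-- `ψ` is an entire function of exponential type (at most) `b`: for every `δ > 0`,
`ψ(z) = O(exp((b + δ)|z|))` on the complex plane. -/
def IsEntireOfExpType (ψ : ℂ → ℂ) (b : ℝ) : Prop :=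
  Differentiable ℂ ψ ∧
    ∀ δ : ℝ, 0 < δ → ∃ C : ℝ, ∀ z : ℂ, ‖ψ z‖ ≤ C * Real.exp ((b + δ) * ‖z‖)

/-- The `n`-th Taylor coefficient of `ψ` at the origin. -/
def taylorCoeffZero (ψ : ℂ → ℂ) (n : ℕ) : ℂ :=
  iteratedDeriv n ψ 0 / (n.factorial : ℂ)

/-- The operator `ψ(D)`, `D = d/dα`, acting on a function `g` of a real variable `α`:
`ψ(D) g (α) = ∑ cₙ g⁽ⁿ⁾(α)`, where `ψ(z) = ∑ cₙ zⁿ`. -/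
def opFun (ψ : ℂ → ℂ) (g : ℝ → ℂ) (α : ℝ) : ℂ :=
  ∑' n : ℕ, taylorCoeffZero ψ n * iteratedDeriv n g α

/-- The function `α ↦ exp(x sin α)`, with values regarded as complex numbers. -/
def expSin (x : ℝ) (α : ℝ) : ℂ :=
  ((Real.exp (x * Real.sin α) : ℝ) : ℂ)

/-- The integrand (in `τ`) of the regularized Kontorovich–Lebedev integral. -/
def klIntegrand (ψ₁ ψ₂ : ℂ → ℂ) (ε x a τ : ℝ) : ℂ :=
  (Real.exp (-ε * τ ^ 2) : ℂ) *
    (ψ₁ τ * (Real.cosh ((Real.pi / 2 + a) * τ) : ℂ)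
      + ψ₂ τ * (τ : ℂ) * (Real.sinh ((Real.pi / 2 + a) * τ) : ℂ)) *
    macdonaldK (Complex.I * τ) x

/-- The regularized Kontorovich–Lebedev integral `f_ε(x, a)`. -/
def klRegularized (ψ₁ ψ₂ : ℂ → ℂ) (ε x a : ℝ) : ℂ :=
  ∫ τ in Ioi (0 : ℝ), klIntegrand ψ₁ ψ₂ ε x a τ

/-- The value `(π/2) [ψ₁(D_a) + D_a ψ₂(D_a)] {exp(x sin a)}`. -/
def klValue (ψ₁ ψ₂ : ℂ → ℂ) (x a : ℝ) : ℂ :=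
  (Real.pi / 2 : ℂ) * (opFun ψ₁ (expSin x) a + deriv (opFun ψ₂ (expSin x)) a)

end

/-! Write N_s(τ) = ∫ e^{iτt} (1 + cosh t)^{-s} dt. Fubini and the Gamma integral show that pairing
K_{iτ}(x) with e^{-x} x^{s-1} gives Γ(s) N_s(τ) / 2
(`integral_expMellinWeight_mul_integral_macdonaldK`). Since (1 + cosh t)^{-s} continues to |Im t| <
π, shifting the contour shows that N_s decays like e^{-θ|τ|} for every θ < π
(`norm_coshPowFourier_le`). This beats the growth of the hyperbolic factors and of ψ_j, so the
Gaussian can be removed by dominated convergence after the pairing.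

Fourier inversion on the line Im t = π/2 + α gives ∫ e^{(π/2+α)τ} N_s(τ) dτ = 2π (1 - sin α)^{-s},
and Γ(s) (1 - sin α)^{-s} is the pairing of e^{x sin α} with the weight. Differentiating n times in
α yields the moment identity `Gamma_mul_integral_pow_mul_exp_mul_coshPowFourier`.

It remains to sum this identity against the Taylor coefficients. Cauchy estimates give |c_n| ≤ C q^n
/ n! for q > e·b, and |D^n e^{x sin a}| ≤ n! R^{-n} e^{ρx} with ρ < 1 for R ≤ (1 - sin a)/2. The
smallness of the types b_j leaves room for q < R, so both sides may be summed under the integral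
sign. -/

/-! ### Cauchy estimates and the operators of infinite order. -/

lemma hasSum_taylorCoeffZero {ψ : ℂ → ℂ} (hψ : Differentiable ℂ ψ) (z : ℂ) :
    HasSum (fun n : ℕ => taylorCoeffZero ψ n * z ^ n) (ψ z) := by
  have h := Complex.hasSum_taylorSeries_of_entire hψ 0 z
  refine h.congr_fun fun n => ?_
  simp only [taylorCoeffZero, sub_zero, smul_eq_mul]
  ring

/-- Cauchy's estimates for the Taylor coefficients of an entire function of exponential type. -/
lemma IsEntireOfExpType.exists_norm_taylorCoeffZero_le {ψ : ℂ → ℂ} {b q : ℝ}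
    (hψ : IsEntireOfExpType ψ b) (hb : 0 ≤ b) (hq : Real.exp 1 * b < q) :
    ∃ C : ℝ, 0 ≤ C ∧ ∀ n : ℕ, ‖taylorCoeffZero ψ n‖ ≤ C * (q ^ n / n.factorial) := by
  have he : 0 < Real.exp 1 := Real.exp_pos 1
  have hq0 : 0 < q := lt_of_le_of_lt (by positivity) hq
  -- This choice of δ makes the growth exponent b + δ equal to q / e.
  obtain ⟨C, hC⟩ := hψ.2 (q / Real.exp 1 - b) (by
    rw [sub_pos, lt_div_iff₀ he]; linarith [mul_comm b (Real.exp 1)])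
  have hC0 : 0 ≤ C := by
    have := (norm_nonneg _).trans (hC 0)
    simpa using this
  refine ⟨C, hC0, fun n => ?_⟩
  rcases Nat.eq_zero_or_pos n with rfl | hn
  · have := hC 0
    simpa [taylorCoeffZero] using this
  -- On this circle the growth bound is C e^n, so the n-th derivative is at most C q^n · n!/n^n.
  -- Estimating n!/n^n by 1 is what costs the factor e in q > e·b.
  set r : ℝ := n * Real.exp 1 / q with hr
  have hn' : (0 : ℝ) < n := by exact_mod_cast hn
  have hr0 : 0 < r := by positivity
  have h := Complex.norm_iteratedDeriv_le_of_forall_mem_sphere_norm_le (c := 0) (R := r)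
    (C := C * Real.exp n) n hr0 hψ.1.diffContOnCl (by
      intro z hz
      rw [mem_sphere_zero_iff_norm] at hz
      refine (hC z).trans_eq ?_
      rw [hz, hr]
      congr 2
      field_simp
      ring)
  rw [taylorCoeffZero, norm_div, Complex.norm_natCast]
  have hf : (0 : ℝ) < n.factorial := by positivity
  rw [div_le_iff₀ hf]
  refine h.trans ?_
  have h1 : Real.exp n = Real.exp 1 ^ n := by
    rw [← Real.exp_nat_mul]; simp
  have h2 : (n.factorial : ℝ) ≤ (n : ℝ) ^ n := by exact_mod_cast Nat.factorial_le_pow n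
  rw [hr, div_pow, mul_pow, h1]
  have h3 : (n.factorial : ℝ) * (C * Real.exp 1 ^ n) / ((n : ℝ) ^ n * Real.exp 1 ^ n / q ^ n)
      = C * q ^ n * (n.factorial / (n : ℝ) ^ n) := by
    field_simp
  rw [h3]
  have h4 : (n.factorial : ℝ) / (n : ℝ) ^ n ≤ 1 := div_le_one_of_le₀ h2 (by positivity)
  have h5 : C * (q ^ n / n.factorial) * n.factorial = C * q ^ n := by field_simp
  rw [h5]
  exact mul_le_of_le_one_right (by positivity) h4

lemma iteratedDeriv_comp_ofReal {F : ℂ → ℂ} (hF : Differentiable ℂ F) (n : ℕ) :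
    iteratedDeriv n (fun t : ℝ => F t) = fun t : ℝ => iteratedDeriv n F t := by
  induction n with
  | zero => simp
  | succ n ih =>
    rw [iteratedDeriv_succ, ih]
    funext t
    have hd : Differentiable ℂ (iteratedDeriv n F) :=
      (hF.contDiff (n := (⊤ : ℕ∞))).differentiable_iteratedDeriv n
        (by exact_mod_cast WithTop.coe_lt_top n)
    rw [iteratedDeriv_succ]
    exact ((hd t).hasDerivAt.comp_ofReal).deriv

lemma expSin_eq (x : ℝ) :
    expSin x = fun t : ℝ => (fun z : ℂ => Complex.exp (x * Complex.sin z)) t := by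
  funext t
  simp [expSin]

/-- Cauchy's estimate for the derivatives of `exp (x sin ·)`. -/
lemma norm_iteratedDeriv_expSin_le {x R ρ α : ℝ} (hx : 0 ≤ x) (hR : 0 < R)
    (hρ : ∀ w : ℂ, ‖w - α‖ ≤ R → (Complex.sin w).re ≤ ρ) (n : ℕ) :
    ‖iteratedDeriv n (expSin x) α‖ ≤ n.factorial / R ^ n * Real.exp (x * ρ) := by
  have hF : Differentiable ℂ (fun z : ℂ => Complex.exp (x * Complex.sin z)) := by fun_prop
  rw [expSin_eq, iteratedDeriv_comp_ofReal hF]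
  refine (Complex.norm_iteratedDeriv_le_of_forall_mem_sphere_norm_le (C := Real.exp (x * ρ)) n hR
    hF.diffContOnCl ?_).trans_eq (by ring)
  intro z hz
  rw [Complex.norm_exp, Complex.re_ofReal_mul]
  exact Real.exp_le_exp.2 (mul_le_mul_of_nonneg_left (hρ z (mem_sphere_iff_norm.1 hz).le) hx)

/-- Joint smoothness serves twice: continuity in x gives measurability under the Mellin integral,
and smoothness in α gives the derivatives. The induction differentiates in the second variable with
the first as a parameter. -/
lemma contDiff_uncurry_iteratedDeriv_expSin (n : ℕ) :
    ContDiff ℝ (⊤ : ℕ∞) (fun p : ℝ × ℝ => iteratedDeriv n (expSin p.1) p.2) := by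
  induction n with
  | zero =>
    simp only [iteratedDeriv_zero]
    exact Complex.ofRealCLM.contDiff.comp
      (by fun_prop : ContDiff ℝ (⊤ : ℕ∞) fun p : ℝ × ℝ => Real.exp (p.1 * Real.sin p.2))
  | succ n ih =>
    simp only [iteratedDeriv_succ]
    simp only [← fderiv_apply_one_eq_deriv]
    refine ContDiff.clm_apply ?_ contDiff_const
    exact ContDiff.fderiv (n := (⊤ : ℕ∞)) (f := fun (p : ℝ × ℝ) (y : ℝ) =>
      iteratedDeriv n (expSin p.1) y) (g := fun p => p.2)
      (ih.comp (by fun_prop : ContDiff ℝ (⊤ : ℕ∞) fun q : (ℝ × ℝ) × ℝ => (q.1.1, q.2)))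
      contDiff_snd (by simp)

lemma continuous_iteratedDeriv_expSin_left (n : ℕ) (α : ℝ) :
    Continuous fun x : ℝ => iteratedDeriv n (expSin x) α :=
  (contDiff_uncurry_iteratedDeriv_expSin n).continuous.comp
    (by fun_prop : Continuous fun x : ℝ => (x, α))

lemma hasDerivAt_iteratedDeriv_expSin (n : ℕ) (x α : ℝ) :
    HasDerivAt (iteratedDeriv n (expSin x)) (iteratedDeriv (n + 1) (expSin x) α) α := by
  rw [iteratedDeriv_succ]
  have : ContDiff ℝ (⊤ : ℕ∞) (iteratedDeriv n (expSin x)) :=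
    (contDiff_uncurry_iteratedDeriv_expSin n).comp
      (by fun_prop : ContDiff ℝ (⊤ : ℕ∞) fun y : ℝ => (x, y))
  exact (this.differentiable (by simp) α).hasDerivAt

lemma Complex.re_sin_eq (w : ℂ) : (Complex.sin w).re = Real.sin w.re * Real.cosh w.im := by
  conv_lhs => rw [← Complex.re_add_im w]
  rw [Complex.sin_add_mul_I]
  simp [← Complex.ofReal_sin, ← Complex.ofReal_cosh, ← Complex.ofReal_cos, ← Complex.ofReal_sinh]

/-- A bound independent of the real part, hence uniform over real centres. It suffices for fixed x,
where the growth in x is immaterial. -/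
lemma re_sin_le_cosh_of_abs_im_le (w : ℂ) {r : ℝ} (h : |w.im| ≤ r) : (Complex.sin w).re ≤ Real.cosh r := by
  rw [Complex.re_sin_eq]
  have h1 : Real.cosh w.im ≤ Real.cosh r := Real.cosh_le_cosh.2 (h.trans (le_abs_self r))
  exact (mul_le_of_le_one_left (Real.cosh_pos _).le (Real.sin_le_one _)).trans h1

/-- The sharper local bound, which keeps the exponential rate in x below 1. To leading order a real
displacement u costs |u|, while an imaginary one v costs only v². -/
lemma re_sin_le_of_norm_sub_le {a : ℝ} {w : ℂ} {r : ℝ} (hr : r ≤ 1 / 2) (h : ‖w - a‖ ≤ r) :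
    (Complex.sin w).re ≤ Real.sin a + r := by
  set u := w.re - a with hu
  set v := w.im with hv
  have hn : u ^ 2 + v ^ 2 ≤ r ^ 2 := by
    have h1 : ‖w - a‖ ^ 2 = u ^ 2 + v ^ 2 := by
      rw [Complex.sq_norm, Complex.normSq_apply]
      simp [hu, hv]; ring
    rw [← h1]
    exact pow_le_pow_left₀ (norm_nonneg _) h 2
  have hr0 : 0 ≤ r := (norm_nonneg _).trans h
  have hu1 : |u| ≤ r := abs_le_of_sq_le_sq (by nlinarith) hr0
  have hv1 : |v| ≤ r := abs_le_of_sq_le_sq (by nlinarith) hr0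
  have hs : Real.sin w.re ≤ Real.sin a + |u| := by
    have := Real.abs_sin_sub_sin_le w.re a
    linarith [le_abs_self (Real.sin w.re - Real.sin a)]
  have hc : Real.cosh v - 1 ≤ v ^ 2 := by
    have h1 : Real.cosh v ≤ Real.exp (v ^ 2 / 2) := Real.cosh_le_exp_half_sq v
    have h2 : v ^ 2 ≤ 1 / 4 := by nlinarith [abs_le.1 hv1]
    have h3 := Real.abs_exp_sub_one_sub_id_le (x := v ^ 2 / 2) (by
      rw [abs_of_nonneg (by positivity)]; linarith)
    have h4 := abs_le.1 h3
    nlinarith [sq_nonneg v]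
  have hc1 : 1 ≤ Real.cosh v := Real.one_le_cosh v
  rw [Complex.re_sin_eq, ← hv]
  have h5 : Real.sin w.re * Real.cosh v ≤ Real.sin w.re + (Real.cosh v - 1) := by
    nlinarith [Real.sin_le_one w.re]
  -- Since v² ≤ (r - |u|)(r + |u|) ≤ (r - |u|)·2r, the condition 2r ≤ 1 suffices.
  have h6 : |u| + v ^ 2 ≤ r := by
    have : u ^ 2 = |u| ^ 2 := (sq_abs u).symm
    nlinarith [abs_nonneg u]
  linarith

/-- Up to a constant this is the negative binomial series ∑ C(n+k, k) (q/R)^n. -/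
lemma summable_pow_div_factorial_mul {q R : ℝ} (hq : 0 ≤ q) (hqR : q < R) (k : ℕ) :
    Summable fun n : ℕ => q ^ n / n.factorial * ((n + k).factorial / R ^ (n + k)) := by
  have hR : 0 < R := hq.trans_lt hqR
  have h := (summable_choose_mul_geometric_of_norm_lt_one k (r := q / R) (by
    rw [Real.norm_of_nonneg (by positivity)]; exact (div_lt_one hR).2 hqR)).mul_left
      (k.factorial / R ^ k : ℝ)
  refine h.congr fun n => ?_
  have h1 : ((n + k).factorial : ℝ) = (n + k).choose k * k.factorial * n.factorial := by
    have := Nat.choose_mul_factorial_mul_factorial (Nat.le_add_left k n)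
    rw [Nat.add_sub_cancel] at this
    exact_mod_cast this.symm
  rw [h1, div_pow, pow_add]
  field_simp

/-- The series obtained by letting `∑ cₙ Dⁿ⁺ᵏ` act on `exp (x sin ·)` are dominated, uniformly on the
real line, by one convergent series. -/
lemma exists_summable_bound_opFun {c : ℕ → ℂ} {C q : ℝ} (hC : 0 ≤ C) (hq : 0 ≤ q)
    (hc : ∀ n, ‖c n‖ ≤ C * (q ^ n / n.factorial)) {x : ℝ} (hx : 0 ≤ x) (k : ℕ) :
    ∃ u : ℕ → ℝ, Summable u ∧
      ∀ n (α : ℝ), ‖c n * iteratedDeriv (n + k) (expSin x) α‖ ≤ u n := by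
  have hR : 0 < q + 1 := by positivity
  refine ⟨_, ((summable_pow_div_factorial_mul hq (lt_add_one q) k).mul_left
    (C * Real.exp (x * Real.cosh (q + 1)))), fun n α => ?_⟩
  have h := norm_iteratedDeriv_expSin_le (α := α) hx hR (ρ := Real.cosh (q + 1)) (fun w hw =>
    re_sin_le_cosh_of_abs_im_le w (by
      have := (Complex.abs_im_le_norm (w - α)).trans hw
      simpa using this)) (n + k)
  rw [norm_mul]
  refine (mul_le_mul (hc n) h (norm_nonneg _) (by positivity)).trans_eq (by ring)

lemma summable_opFun {c : ℕ → ℂ} {C q : ℝ} (hC : 0 ≤ C) (hq : 0 ≤ q)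
    (hc : ∀ n, ‖c n‖ ≤ C * (q ^ n / n.factorial)) {x : ℝ} (hx : 0 ≤ x) (k : ℕ) (α : ℝ) :
    Summable fun n => c n * iteratedDeriv (n + k) (expSin x) α := by
  obtain ⟨u, hu, h⟩ := exists_summable_bound_opFun hC hq hc hx k
  exact Summable.of_norm_bounded hu fun n => h n α

lemma hasDerivAt_opFun {ψ : ℂ → ℂ} {C q : ℝ} (hC : 0 ≤ C) (hq : 0 ≤ q)
    (hc : ∀ n, ‖taylorCoeffZero ψ n‖ ≤ C * (q ^ n / n.factorial)) {x : ℝ} (hx : 0 ≤ x) (α : ℝ) :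
    HasDerivAt (opFun ψ (expSin x))
      (∑' n : ℕ, taylorCoeffZero ψ n * iteratedDeriv (n + 1) (expSin x) α) α := by
  obtain ⟨u, hu, h⟩ := exists_summable_bound_opFun hC hq hc hx 1
  exact hasDerivAt_tsum hu
    (fun n y => (hasDerivAt_iteratedDeriv_expSin n x y).const_mul (taylorCoeffZero ψ n))
    h (summable_opFun hC hq hc hx 0 0) α

lemma klValue_eq {ψ₁ ψ₂ : ℂ → ℂ} {C q : ℝ} (hC : 0 ≤ C) (hq : 0 ≤ q)
    (hc : ∀ n, ‖taylorCoeffZero ψ₂ n‖ ≤ C * (q ^ n / n.factorial)) {x : ℝ} (hx : 0 ≤ x) (a : ℝ) :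
    klValue ψ₁ ψ₂ x a = (Real.pi / 2 : ℂ) *
      ((∑' n : ℕ, taylorCoeffZero ψ₁ n * iteratedDeriv (n + 0) (expSin x) a) +
        ∑' n : ℕ, taylorCoeffZero ψ₂ n * iteratedDeriv (n + 1) (expSin x) a) := by
  rw [klValue, (hasDerivAt_opFun hC hq hc hx a).deriv]
  rfl

/-! ### Contour shift in a strip. -/

lemma integrable_exp_neg_mul_abs {σ : ℝ} (hσ : 0 < σ) :
    Integrable fun x : ℝ => Real.exp (-σ * |x|) := by
  rw [← integrableOn_univ, ← Iic_union_Ioi (a := (0 : ℝ)), integrableOn_union]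
  have h : IntegrableOn (fun x : ℝ => Real.exp (-σ * |x|)) (Ioi 0) :=
    (exp_neg_integrableOn_Ioi 0 hσ).congr_fun
      (fun x hx => by simp only [abs_of_pos (mem_Ioi.1 hx)]) measurableSet_Ioi
  refine ⟨?_, h⟩
  have h' := (integrableOn_Ici_iff_integrableOn_Ioi).2 h
  rw [← neg_zero] at h'
  simpa using h'.comp_neg_Iic

/-- The integral of an exponentially decaying holomorphic function over a horizontal line may be
shifted within a strip. -/
lemma integral_horizontal_shift {F : ℂ → ℂ} {σ C θ : ℝ} (hσ : 0 < σ)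
    (hF : DifferentiableOn ℂ F {z | |z.im| ≤ |θ|})
    (hb : ∀ x y : ℝ, |y| ≤ |θ| → ‖F (x + y * Complex.I)‖ ≤ C * Real.exp (-σ * |x|)) :
    ∫ x : ℝ, F (x + θ * Complex.I) = ∫ x : ℝ, F x := by
  have hint : ∀ y : ℝ, |y| ≤ |θ| → Integrable fun x : ℝ => F (x + y * Complex.I) := by
    intro y hy
    refine Integrable.mono' ((integrable_exp_neg_mul_abs hσ).const_mul C) ?_
      (Eventually.of_forall fun x => hb x y hy)
    have : Continuous fun x : ℝ => F (x + y * Complex.I) :=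
      hF.continuousOn.comp_continuous (by fun_prop) (fun x => by simpa using hy)
    exact this.aestronglyMeasurable
  have h1 := intervalIntegral_tendsto_integral (hint θ le_rfl) tendsto_neg_atTop_atBot tendsto_id
  have h2 := intervalIntegral_tendsto_integral (hint 0 (by simp)) tendsto_neg_atTop_atBot tendsto_id
  -- The values ε = 1 and ε = -1 give the two vertical sides of the rectangle, which vanish as T →
  -- ∞.
  have hv : ∀ ε : ℝ, |ε| = 1 → Tendsto
      (fun T : ℝ => ∫ y : ℝ in (0 : ℝ)..θ, F ((ε * T : ℝ) + y * Complex.I)) atTop (𝓝 0) := by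
    intro ε hε
    have h3 : Tendsto (fun T : ℝ => C * Real.exp (-σ * T) * |θ - 0|) atTop (𝓝 0) := by
      have : Tendsto (fun T : ℝ => Real.exp (-σ * T)) atTop (𝓝 0) :=
        Real.tendsto_exp_atBot.comp (tendsto_id.const_mul_atTop_of_neg (neg_lt_zero.2 hσ))
      simpa using (this.const_mul C).mul_const |θ - 0|
    refine squeeze_zero_norm' ?_ h3
    filter_upwards [eventually_ge_atTop 0] with T hT
    refine intervalIntegral.norm_integral_le_of_norm_le_const fun y hy => ?_
    refine (hb _ y ?_).trans_eq ?_
    · simpa using abs_sub_left_of_mem_uIcc (uIoc_subset_uIcc hy)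
    · rw [abs_mul, hε, one_mul, abs_of_nonneg hT]
  have h3 := hv 1 (by simp)
  have h4 := hv (-1) (by simp)
  have key : ∀ T : ℝ, ∫ x in -T..T, F (x + θ * Complex.I) =
      (∫ x in -T..T, F (x + (0 : ℝ) * Complex.I)) +
      (Complex.I * (∫ y : ℝ in (0 : ℝ)..θ, F ((1 * T : ℝ) + y * Complex.I)) -
       Complex.I * (∫ y : ℝ in (0 : ℝ)..θ, F ((-1 * T : ℝ) + y * Complex.I))) := by
    intro T
    have := Complex.integral_boundary_rect_eq_zero_of_differentiableOn F (-T) (T + θ * Complex.I)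
      (hF.mono fun z hz => by
        have h := hz.2
        simp only [Complex.neg_im, Complex.ofReal_im, neg_zero, Complex.add_im, Complex.mul_im,
          Complex.ofReal_re, Complex.I_im, mul_one, Complex.I_re, mul_zero, add_zero, zero_add,
          mem_preimage] at h
        simpa using abs_sub_left_of_mem_uIcc h)
    simp only [Complex.neg_im, Complex.ofReal_im, neg_zero, Complex.add_im, Complex.mul_im,
      Complex.ofReal_re, Complex.I_im, mul_one, Complex.I_re, mul_zero, add_zero, zero_add,
      Complex.neg_re, Complex.add_re, Complex.mul_re, sub_zero, smul_eq_mul] at this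
    simp only [one_mul, neg_mul]
    linear_combination -this
  have h5 := h2.add ((h3.const_mul Complex.I).sub (h4.const_mul Complex.I))
  have h6 := tendsto_nhds_unique h1 (h5.congr fun T => (key T).symm)
  rw [h6]
  simp

/-! ### Analytic continuation of (1 + cosh t)^{-s}. -/

/-- `2⁻ˢ cosh (z / 2) ^ (-2 s)`, the continuation of `(1 + cosh t)⁻ˢ` to the strip `|Im z| < π`. -/
noncomputable def coshPow (s z : ℂ) : ℂ := (2 : ℂ) ^ (-s) * Complex.cosh (z / 2) ^ (-2 * s)

lemma re_cosh_half (x y : ℝ) :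
    (Complex.cosh ((x + y * Complex.I) / 2)).re = Real.cosh (x / 2) * Real.cos (y / 2) := by
  have : ((x : ℂ) + y * Complex.I) / 2 = ((x / 2 : ℝ) : ℂ) + ((y / 2 : ℝ) : ℂ) * Complex.I := by
    push_cast; ring
  rw [this, Complex.cosh_add, Complex.cosh_mul_I, Complex.sinh_mul_I, ← Complex.ofReal_sin,
    ← Complex.ofReal_cosh, ← Complex.ofReal_cos, ← Complex.ofReal_sinh]
  simp only [Complex.add_re, Complex.mul_re, Complex.ofReal_re, Complex.ofReal_im, Complex.mul_im,
    Complex.I_re, Complex.I_im]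
  ring

lemma cos_half_pos {y : ℝ} (hy : |y| < Real.pi) : 0 < Real.cos (y / 2) := by
  have := abs_lt.1 hy
  exact Real.cos_pos_of_mem_Ioo ⟨by linarith, by linarith⟩

/-- The half-angle form keeps the base of the power in the right half-plane, off the branch cut,
throughout the strip. -/
lemma re_cosh_half_pos {z : ℂ} (hz : |z.im| < Real.pi) : 0 < (Complex.cosh (z / 2)).re := by
  rw [← Complex.re_add_im z, re_cosh_half]
  exact mul_pos (Real.cosh_pos _) (cos_half_pos hz)

lemma differentiableAt_coshPow (s : ℂ) {z : ℂ} (hz : |z.im| < Real.pi) :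
    DifferentiableAt ℂ (coshPow s) z := by
  unfold coshPow
  refine DifferentiableAt.const_mul ?_ _
  refine DifferentiableAt.cpow_const (by fun_prop) (Or.inl (re_cosh_half_pos hz))

lemma coshPow_neg (s z : ℂ) : coshPow s (-z) = coshPow s z := by
  rw [coshPow, coshPow, neg_div, Complex.cosh_neg]

lemma two_cpow_mul_cpow_neg_two {s : ℂ} {r : ℝ} (hr : 0 < r) :
    (2 : ℂ) ^ (-s) * (r : ℂ) ^ (-2 * s) = ((2 * r ^ 2 : ℝ) : ℂ) ^ (-s) := by
  have h2 : (2 : ℂ) = ((2 : ℝ) : ℂ) := by simp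
  have hl : Real.log (2 * r ^ 2) = Real.log 2 + 2 * Real.log r := by
    rw [Real.log_mul (by norm_num) (by positivity), Real.log_pow]; simp
  rw [Complex.cpow_def_of_ne_zero (by simp), Complex.cpow_def_of_ne_zero (by simpa using hr.ne'),
    Complex.cpow_def_of_ne_zero (by rw [Complex.ofReal_ne_zero]; positivity), ← Complex.exp_add,
    ← Complex.ofReal_log hr.le,
    ← Complex.ofReal_log (by positivity : (0 : ℝ) ≤ 2 * r ^ 2), hl]
  nth_rewrite 1 [h2]
  rw [← Complex.ofReal_log (by positivity)]
  push_cast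
  ring_nf

lemma coshPow_ofReal (s : ℂ) (t : ℝ) :
    coshPow s t = ((1 + Real.cosh t : ℝ) : ℂ) ^ (-s) := by
  have h : Complex.cosh ((t : ℂ) / 2) = ((Real.cosh (t / 2) : ℝ) : ℂ) := by push_cast; rfl
  rw [coshPow, h, two_cpow_mul_cpow_neg_two (Real.cosh_pos _)]
  have h2 : Real.cosh t = 2 * Real.cosh (t / 2) ^ 2 - 1 := by
    have := Real.cosh_two_mul (t / 2)
    rw [Real.sinh_sq, mul_div_cancel₀ _ (by norm_num : (2 : ℝ) ≠ 0)] at this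
    linarith
  rw [h2]; ring_nf

lemma coshPow_mul_I (s : ℂ) {θ : ℝ} (hθ : |θ| < Real.pi) :
    coshPow s (θ * Complex.I) = ((1 + Real.cos θ : ℝ) : ℂ) ^ (-s) := by
  have h : Complex.cosh ((θ : ℂ) * Complex.I / 2) = ((Real.cos (θ / 2) : ℝ) : ℂ) := by
    rw [mul_div_right_comm, Complex.cosh_mul_I]; push_cast; rfl
  rw [coshPow, h, two_cpow_mul_cpow_neg_two (cos_half_pos hθ), Real.cos_sq]
  rw [mul_div_cancel₀ _ (by norm_num : (2 : ℝ) ≠ 0)]; ring_nf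

/-- In the strip, Re cosh(z/2) = cosh(x/2) cos(y/2) is at least a constant times e^{|x|/2}, and the
exponent -2s turns this into e^{-Re s·|x|}. The imaginary part of s contributes only a bounded
factor because |arg| ≤ π. -/
lemma norm_coshPow_le {s : ℂ} (hs : 0 < s.re) {θ : ℝ} (hθ : |θ| < Real.pi) :
    ∃ C : ℝ, 0 ≤ C ∧ ∀ x y : ℝ, |y| ≤ |θ| →
      ‖coshPow s (x + y * Complex.I)‖ ≤ C * Real.exp (-s.re * |x|) := by
  set κ := Real.cos (θ / 2) with hκ
  have hκ0 : 0 < κ := cos_half_pos hθ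
  refine ⟨‖(2 : ℂ) ^ (-s)‖ * (κ / 2) ^ (-2 * s.re) * Real.exp (Real.pi * (2 * |s.im|)),
    by positivity, fun x y hy => ?_⟩
  set w := Complex.cosh ((x + y * Complex.I) / 2) with hw
  have hcos : κ ≤ Real.cos (y / 2) := by
    rw [hκ, ← Real.cos_abs (θ / 2), ← Real.cos_abs (y / 2), abs_div, abs_div]
    simp only [abs_two]
    have := Real.pi_pos
    exact Real.cos_le_cos_of_nonneg_of_le_pi (by positivity) (by linarith) (by linarith)
  have hcosh : Real.exp (|x| / 2) / 2 ≤ Real.cosh (x / 2) := by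
    rw [← Real.cosh_abs, abs_div, abs_two, Real.cosh_eq]
    have := Real.exp_pos (-(|x| / 2))
    linarith
  have hwre : κ / 2 * Real.exp (|x| / 2) ≤ w.re := by
    rw [hw, re_cosh_half]
    calc κ / 2 * Real.exp (|x| / 2) = Real.exp (|x| / 2) / 2 * κ := by ring
      _ ≤ _ := mul_le_mul hcosh hcos hκ0.le (Real.cosh_pos _).le
  have hwn : κ / 2 * Real.exp (|x| / 2) ≤ ‖w‖ := hwre.trans ((le_abs_self _).trans (Complex.abs_re_le_norm w))
  have h1 : ‖w ^ (-2 * s)‖ ≤ ‖w‖ ^ (-2 * s.re) * Real.exp (Real.pi * (2 * |s.im|)) := by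
    refine (Complex.norm_cpow_le _ _).trans ?_
    have e1 : (-2 * s).re = -2 * s.re := by simp
    have e2 : (-2 * s).im = -2 * s.im := by simp
    rw [e1, e2, div_eq_mul_inv, ← Real.exp_neg]
    refine mul_le_mul_of_nonneg_left (Real.exp_le_exp.2 ?_) (by positivity)
    have h3 := Complex.abs_arg_le_pi w
    calc -(w.arg * (-2 * s.im)) ≤ |-(w.arg * (-2 * s.im))| := le_abs_self _
      _ = |w.arg| * (2 * |s.im|) := by rw [abs_neg, abs_mul, abs_mul]; simp
      _ ≤ _ := by gcongr
  have h2 : ‖w‖ ^ (-2 * s.re) ≤ (κ / 2) ^ (-2 * s.re) * Real.exp (-s.re * |x|) := by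
    refine (Real.rpow_le_rpow_of_nonpos (by positivity) hwn (by linarith)).trans_eq ?_
    rw [Real.mul_rpow (by positivity) (by positivity), ← Real.exp_mul]
    ring_nf
  rw [coshPow, norm_mul, ← hw]
  calc ‖(2 : ℂ) ^ (-s)‖ * ‖w ^ (-2 * s)‖
      ≤ ‖(2 : ℂ) ^ (-s)‖ * ((κ / 2) ^ (-2 * s.re) * Real.exp (-s.re * |x|) *
        Real.exp (Real.pi * (2 * |s.im|))) := by
        refine mul_le_mul_of_nonneg_left (h1.trans ?_) (norm_nonneg _)
        exact mul_le_mul_of_nonneg_right h2 (Real.exp_pos _).le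
    _ = _ := by ring

/-! ### The Fourier transform of (1 + cosh t)^{-s}: decay and inversion. -/

/-- `∫ exp (i τ t) (1 + cosh t)⁻ˢ dt`. -/
noncomputable def coshPowFourier (s : ℂ) (τ : ℝ) : ℂ :=
  ∫ t : ℝ, Complex.exp (Complex.I * τ * t) * coshPow s t

lemma norm_exp_I_mul_mul (τ t : ℝ) : ‖Complex.exp (Complex.I * τ * t)‖ = 1 := by
  rw [Complex.norm_exp]; simp

lemma continuous_coshPow_line (s : ℂ) {θ : ℝ} (hθ : |θ| < Real.pi) :
    Continuous fun t : ℝ => coshPow s (t + θ * Complex.I) := by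
  rw [continuous_iff_continuousAt]
  intro t
  have h := (differentiableAt_coshPow s (z := t + θ * Complex.I) (by simpa using hθ)).continuousAt
  exact h.comp (f := fun t : ℝ => (t : ℂ) + θ * Complex.I) (by fun_prop)

lemma integrable_coshPow_line {s : ℂ} (hs : 0 < s.re) {θ : ℝ} (hθ : |θ| < Real.pi) :
    Integrable fun t : ℝ => coshPow s (t + θ * Complex.I) := by
  obtain ⟨C, _, h⟩ := norm_coshPow_le hs hθ
  exact Integrable.mono' ((integrable_exp_neg_mul_abs hs).const_mul C)
    (continuous_coshPow_line s hθ).aestronglyMeasurable (Eventually.of_forall fun x => h x θ le_rfl)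

lemma continuous_coshPow (s : ℂ) : Continuous fun t : ℝ => coshPow s t := by
  simpa using continuous_coshPow_line s (θ := 0) (by simpa using Real.pi_pos)

lemma integrable_coshPow {s : ℂ} (hs : 0 < s.re) : Integrable fun t : ℝ => coshPow s t := by
  simpa using integrable_coshPow_line hs (θ := 0) (by simpa using Real.pi_pos)

/-- Moving the line of integration to height θ produces a factor e^{-θτ}, which the exponential on
the left cancels. -/
lemma exp_mul_coshPowFourier {s : ℂ} (hs : 0 < s.re) {θ : ℝ} (hθ : |θ| < Real.pi) (τ : ℝ) :
    Complex.exp (θ * τ) * coshPowFourier s τ =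
      ∫ t : ℝ, Complex.exp (Complex.I * τ * t) * coshPow s (t + θ * Complex.I) := by
  obtain ⟨C, hC, h⟩ := norm_coshPow_le hs hθ
  have key := integral_horizontal_shift
    (F := fun z => Complex.exp (Complex.I * τ * z) * coshPow s z) (θ := θ)
    (C := Real.exp (|θ| * |τ|) * C) hs ?_ ?_
  · rw [coshPowFourier, ← key, ← integral_const_mul]
    congr 1
    funext t
    rw [← mul_assoc, ← Complex.exp_add]
    congr 2
    linear_combination (θ * τ : ℂ) * Complex.I_sq
  · intro z hz
    exact (DifferentiableAt.mul (by fun_prop)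
      (differentiableAt_coshPow s (lt_of_le_of_lt hz hθ))).differentiableWithinAt
  · intro x y hy
    rw [norm_mul, mul_assoc (Real.exp _)]
    refine mul_le_mul ?_ (h x y hy) (norm_nonneg _) (Real.exp_pos _).le
    rw [Complex.norm_exp]
    refine Real.exp_le_exp.2 ?_
    have : (Complex.I * τ * (x + y * Complex.I)).re = -(τ * y) := by simp
    rw [this]
    calc -(τ * y) ≤ |-(τ * y)| := le_abs_self _
      _ = |y| * |τ| := by rw [abs_neg, abs_mul, mul_comm]
      _ ≤ _ := by gcongr

lemma coshPowFourier_neg (s : ℂ) (τ : ℝ) : coshPowFourier s (-τ) = coshPowFourier s τ := by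
  rw [coshPowFourier, ← integral_neg_eq_self, coshPowFourier]
  congr 1
  funext t
  push_cast
  rw [coshPow_neg]
  ring_nf

lemma continuous_coshPowFourier {s : ℂ} (hs : 0 < s.re) : Continuous (coshPowFourier s) := by
  refine continuous_of_dominated (bound := fun t : ℝ => ‖coshPow s t‖) ?_ ?_
    (integrable_coshPow hs).norm ?_
  · intro τ
    have := continuous_coshPow s
    exact (by fun_prop : Continuous fun t : ℝ =>
      Complex.exp (Complex.I * τ * t) * coshPow s t).aestronglyMeasurable
  · intro τ
    refine Eventually.of_forall fun t => ?_
    rw [norm_mul, norm_exp_I_mul_mul, one_mul]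
  · exact Eventually.of_forall fun t => by fun_prop

/-- The shifted integral bounds e^{θ|τ|} times the transform; evenness reduces the claim to |τ|. -/
lemma norm_coshPowFourier_le {s : ℂ} (hs : 0 < s.re) {θ : ℝ} (h0 : 0 ≤ θ) (hθ : θ < Real.pi) :
    ∃ C : ℝ, 0 ≤ C ∧ ∀ τ : ℝ, ‖coshPowFourier s τ‖ ≤ C * Real.exp (-θ * |τ|) := by
  have hθ' : |θ| < Real.pi := by rwa [abs_of_nonneg h0]
  refine ⟨∫ t : ℝ, ‖coshPow s (t + θ * Complex.I)‖, by positivity, fun τ => ?_⟩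
  have hτ : coshPowFourier s |τ| = coshPowFourier s τ := by
    rcases abs_choice τ with h | h
    · rw [h]
    · rw [h, coshPowFourier_neg]
  have h := exp_mul_coshPowFourier hs hθ' |τ|
  rw [hτ] at h
  have h1 : ‖Complex.exp (θ * (|τ| : ℝ)) * coshPowFourier s τ‖ ≤
      ∫ t : ℝ, ‖coshPow s (t + θ * Complex.I)‖ := by
    rw [h]
    refine (norm_integral_le_integral_norm _).trans_eq ?_
    congr 1
    funext t
    rw [norm_mul, norm_exp_I_mul_mul, one_mul]
  rw [norm_mul, Complex.norm_exp, ← Complex.ofReal_mul, Complex.ofReal_re] at h1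
  rw [neg_mul, Real.exp_neg, ← div_eq_mul_inv, le_div_iff₀ (Real.exp_pos _), mul_comm]
  exact h1

open FourierTransform in
/-- Fourier inversion for `(1 + cosh t)⁻ˢ` on the line `Im t = θ`. -/
lemma integral_exp_mul_coshPowFourier {s : ℂ} (hs : 0 < s.re) {θ : ℝ} (hθ : |θ| < Real.pi) :
    ∫ τ : ℝ, Complex.exp (θ * τ) * coshPowFourier s τ =
      2 * Real.pi * coshPow s (θ * Complex.I) := by
  have hpi := Real.pi_pos
  set f : ℝ → ℂ := fun t => coshPow s (t + θ * Complex.I) with hf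
  set g : ℝ → ℂ := fun τ => Complex.exp (θ * τ) * coshPowFourier s τ with hg
  -- The kernel e^{-2πiξt} corresponds to τ = -2πξ.
  have hF : 𝓕 f = fun ξ : ℝ => g (-(2 * Real.pi) * ξ) := by
    funext ξ
    rw [Real.fourier_real_eq_integral_exp_smul, hg]
    dsimp only
    rw [exp_mul_coshPowFourier hs hθ]
    congr 1
    funext t
    rw [smul_eq_mul]
    congr 2
    push_cast; ring
  have hgi : Integrable g := by
    -- A decay rate halfway between |θ| and π leaves a net rate (π - |θ|)/2.
    obtain ⟨C, hC, h⟩ := norm_coshPowFourier_le hs (θ := (|θ| + Real.pi) / 2)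
      (by positivity) (by linarith)
    have hc := continuous_coshPowFourier hs
    refine Integrable.mono' ((integrable_exp_neg_mul_abs
      (show 0 < (Real.pi - |θ|) / 2 by linarith)).const_mul C)
      (by fun_prop : Continuous g).aestronglyMeasurable (Eventually.of_forall fun τ => ?_)
    rw [hg, norm_mul, ← Complex.ofReal_mul, Complex.norm_exp, Complex.ofReal_re]
    calc Real.exp (θ * τ) * ‖coshPowFourier s τ‖
        ≤ Real.exp (|θ| * |τ|) * (C * Real.exp (-((|θ| + Real.pi) / 2) * |τ|)) := by
          refine mul_le_mul (Real.exp_le_exp.2 ?_) (h τ) (norm_nonneg _) (Real.exp_pos _).le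
          rw [← abs_mul]; exact le_abs_self _
      _ = _ := by
          rw [mul_left_comm, ← Real.exp_add]; ring_nf
  have hFi : Integrable (𝓕 f) := by
    rw [hF]; exact hgi.comp_mul_left' (by simp [hpi.ne'])
  have hinv : 𝓕⁻ (𝓕 f) 0 = f 0 := (integrable_coshPow_line hs hθ).fourierInv_fourier_eq hFi
    (continuous_coshPow_line s hθ).continuousAt
  rw [Real.fourierInv_eq', hF] at hinv
  simp only [inner_zero_right, mul_zero, Complex.ofReal_zero, zero_mul, Complex.exp_zero,
    one_smul] at hinv
  rw [Measure.integral_comp_mul_left g] at hinv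
  rw [abs_inv, abs_neg, abs_of_pos (by positivity), inv_smul_eq_iff₀ (by positivity)] at hinv
  rw [hinv, Complex.real_smul, hf]
  push_cast
  simp

/-! ### Moments on both sides and their derivatives in α. -/

lemma integrable_abs_pow_mul_exp_neg_mul_abs {δ : ℝ} (hδ : 0 < δ) (n : ℕ) :
    Integrable fun x : ℝ => |x| ^ n * Real.exp (-δ * |x|) := by
  refine Integrable.mono' ((integrable_exp_neg_mul_abs (half_pos hδ)).const_mul
    (n.factorial / (δ / 2) ^ n)) (by fun_prop : Continuous fun x : ℝ =>
      |x| ^ n * Real.exp (-δ * |x|)).aestronglyMeasurable (Eventually.of_forall fun x => ?_)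
  rw [Real.norm_of_nonneg (by positivity)]
  have h := Real.pow_div_factorial_le_exp (δ / 2 * |x|) (by positivity) n
  rw [div_le_iff₀ (by positivity), mul_pow] at h
  have h2 : |x| ^ n ≤ n.factorial / (δ / 2) ^ n * Real.exp (δ / 2 * |x|) := by
    rw [div_mul_eq_mul_div, le_div_iff₀ (by positivity)]
    linarith
  calc |x| ^ n * Real.exp (-δ * |x|)
      ≤ n.factorial / (δ / 2) ^ n * Real.exp (δ / 2 * |x|) * Real.exp (-δ * |x|) := by gcongr
    _ = _ := by rw [mul_assoc, ← Real.exp_add]; ring_nf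

/-- The weight `e⁻ˣ xˢ⁻¹` of the generalized Mellin transform. -/
noncomputable def expMellinWeight (s : ℂ) (x : ℝ) : ℂ := (x : ℂ) ^ (s - 1) * (Real.exp (-x) : ℂ)

lemma norm_expMellinWeight {s : ℂ} {x : ℝ} (hx : 0 < x) :
    ‖expMellinWeight s x‖ = x ^ (s.re - 1) * Real.exp (-x) := by
  rw [expMellinWeight, norm_mul, Complex.norm_cpow_eq_rpow_re_of_pos hx, Complex.norm_real,
    Real.norm_of_nonneg (Real.exp_pos _).le]
  simp

lemma continuousOn_expMellinWeight (s : ℂ) : ContinuousOn (expMellinWeight s) (Ioi 0) := by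
  unfold expMellinWeight
  refine ContinuousOn.mul (fun x hx => ?_) (by fun_prop)
  exact (Complex.continuousAt_ofReal_cpow_const x (s - 1) (Or.inr (ne_of_gt hx))).continuousWithinAt

lemma integrableOn_rpow_mul_exp_neg_mul {σ b : ℝ} (hσ : 0 < σ) (hb : 0 < b) :
    IntegrableOn (fun x : ℝ => x ^ (σ - 1) * Real.exp (-b * x)) (Ioi 0) := by
  simpa using integrableOn_rpow_mul_exp_neg_mul_rpow (s := σ - 1) (p := 1) (by linarith) one_pos hb

/-- The weight e^{-x} absorbs the Cauchy bound e^{ρx}, so the right side is integrable as soon as ρ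
< 1. -/
lemma norm_expMellinWeight_mul_iteratedDeriv_le {s : ℂ} {R ρ α x : ℝ} (hR : 0 < R)
    (hρ : ∀ w : ℂ, ‖w - α‖ ≤ R → (Complex.sin w).re ≤ ρ) (hx : 0 < x) (n : ℕ) :
    ‖expMellinWeight s x * iteratedDeriv n (expSin x) α‖ ≤
      n.factorial / R ^ n * (x ^ (s.re - 1) * Real.exp (-(1 - ρ) * x)) := by
  rw [norm_mul, norm_expMellinWeight hx]
  refine (mul_le_mul_of_nonneg_left (norm_iteratedDeriv_expSin_le hx.le hR hρ n)
    (by positivity)).trans_eq ?_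
  have : Real.exp (-(1 - ρ) * x) = Real.exp (-x) * Real.exp (x * ρ) := by
    rw [← Real.exp_add]; ring_nf
  rw [this]; ring

lemma aestronglyMeasurable_expMellinWeight_mul_iteratedDeriv (s : ℂ) (n : ℕ) (α : ℝ) :
    AEStronglyMeasurable (fun x : ℝ => expMellinWeight s x * iteratedDeriv n (expSin x) α)
      (volume.restrict (Ioi 0)) :=
  ((continuousOn_expMellinWeight s).mul
    (continuous_iteratedDeriv_expSin_left n α).continuousOn).aestronglyMeasurable measurableSet_Ioi

/-- The Mellin-type moments of the derivatives of `exp (x sin ·)` are derivatives of each other. -/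
lemma hasDerivAt_integral_expMellinWeight_mul_iteratedDeriv {s : ℂ} (hs : 0 < s.re) {a η R ρ : ℝ}
    (hR : 0 < R) (hρ1 : ρ < 1)
    (hρ : ∀ α ∈ Metric.ball a η, ∀ w : ℂ, ‖w - α‖ ≤ R → (Complex.sin w).re ≤ ρ)
    (n : ℕ) {α : ℝ} (hα : α ∈ Metric.ball a η) :
    HasDerivAt (fun α => ∫ x in Ioi (0 : ℝ), expMellinWeight s x * iteratedDeriv n (expSin x) α)
      (∫ x in Ioi (0 : ℝ), expMellinWeight s x * iteratedDeriv (n + 1) (expSin x) α) α := by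
  have hW := integrableOn_rpow_mul_exp_neg_mul hs (sub_pos.2 hρ1)
  refine (hasDerivAt_integral_of_dominated_loc_of_deriv_le (Metric.isOpen_ball.mem_nhds hα)
    (F := fun α x => expMellinWeight s x * iteratedDeriv n (expSin x) α)
    (F' := fun α x => expMellinWeight s x * iteratedDeriv (n + 1) (expSin x) α)
    (Eventually.of_forall fun _ => aestronglyMeasurable_expMellinWeight_mul_iteratedDeriv s n _)
    ?_ (aestronglyMeasurable_expMellinWeight_mul_iteratedDeriv s (n + 1) α) ?_
    (hW.const_mul ((n + 1).factorial / R ^ (n + 1))) ?_).2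
  · refine Integrable.mono' (hW.const_mul (n.factorial / R ^ n))
      (aestronglyMeasurable_expMellinWeight_mul_iteratedDeriv s n α) ?_
    filter_upwards [ae_restrict_mem measurableSet_Ioi] with x hx
    exact norm_expMellinWeight_mul_iteratedDeriv_le hR (hρ α hα) hx n
  · filter_upwards [ae_restrict_mem measurableSet_Ioi] with x hx β hβ
    exact norm_expMellinWeight_mul_iteratedDeriv_le hR (hρ β hβ) hx (n + 1)
  · exact Eventually.of_forall fun x β _ => (hasDerivAt_iteratedDeriv_expSin n x β).const_mul _

/-- Exponential moments of `coshPowFourier` are derivatives of each other. -/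
lemma hasDerivAt_integral_pow_mul_exp_mul_coshPowFourier {s : ℂ} (hs : 0 < s.re) {a η Θ : ℝ}
    (hΘ : Θ < Real.pi) (hη : ∀ α ∈ Metric.ball a η, |Real.pi / 2 + α| ≤ Θ)
    (n : ℕ) {α : ℝ} (hα : α ∈ Metric.ball a η) :
    HasDerivAt (fun α : ℝ => ∫ τ : ℝ, (τ : ℂ) ^ n *
        (Complex.exp ((Real.pi / 2 + α : ℝ) * τ) * coshPowFourier s τ))
      (∫ τ : ℝ, (τ : ℂ) ^ (n + 1) *
        (Complex.exp ((Real.pi / 2 + α : ℝ) * τ) * coshPowFourier s τ)) α := by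
  have hΘ0 : 0 ≤ Θ := (abs_nonneg _).trans (hη α hα)
  obtain ⟨C, hC, h⟩ := norm_coshPowFourier_le hs (θ := (Θ + Real.pi) / 2)
    (by linarith) (by linarith)
  have hc := continuous_coshPowFourier hs
  have hδ : 0 < (Real.pi - Θ) / 2 := by linarith
  have hbd : ∀ m : ℕ, ∀ β ∈ Metric.ball a η, ∀ τ : ℝ, ‖(τ : ℂ) ^ m *
        (Complex.exp ((Real.pi / 2 + β : ℝ) * τ) * coshPowFourier s τ)‖ ≤
        C * (|τ| ^ m * Real.exp (-((Real.pi - Θ) / 2) * |τ|)) := by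
    intro m β hβ τ
    rw [norm_mul, norm_mul, norm_pow, Complex.norm_real, Real.norm_eq_abs, ← Complex.ofReal_mul,
      Complex.norm_exp, Complex.ofReal_re]
    calc |τ| ^ m * (Real.exp ((Real.pi / 2 + β) * τ) * ‖coshPowFourier s τ‖)
        ≤ |τ| ^ m * (Real.exp (Θ * |τ|) * (C * Real.exp (-((Θ + Real.pi) / 2) * |τ|))) := by
          refine mul_le_mul_of_nonneg_left (mul_le_mul (Real.exp_le_exp.2 ?_) (h τ)
            (norm_nonneg _) (Real.exp_pos _).le) (by positivity)
          refine (le_abs_self _).trans ?_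
          rw [abs_mul]
          exact mul_le_mul_of_nonneg_right (hη β hβ) (abs_nonneg _)
      _ = _ := by
          rw [mul_left_comm (Real.exp _), ← Real.exp_add, mul_left_comm]; ring_nf
  have hcont : ∀ m : ℕ, ∀ β : ℝ, Continuous fun τ : ℝ => (τ : ℂ) ^ m *
        (Complex.exp ((Real.pi / 2 + β : ℝ) * τ) * coshPowFourier s τ) := fun m β => by fun_prop
  refine (hasDerivAt_integral_of_dominated_loc_of_deriv_le (Metric.isOpen_ball.mem_nhds hα)
    (F := fun (α τ : ℝ) => (τ : ℂ) ^ n *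
        (Complex.exp ((Real.pi / 2 + α : ℝ) * τ) * coshPowFourier s τ))
    (F' := fun (α τ : ℝ) => (τ : ℂ) ^ (n + 1) *
        (Complex.exp ((Real.pi / 2 + α : ℝ) * τ) * coshPowFourier s τ))
    (Eventually.of_forall fun β => (hcont n β).aestronglyMeasurable)
    ?_ (hcont (n + 1) α).aestronglyMeasurable (Eventually.of_forall fun τ β hβ => hbd (n + 1) β hβ τ)
    ((integrable_abs_pow_mul_exp_neg_mul_abs hδ (n + 1)).const_mul C) ?_).2
  · exact Integrable.mono' ((integrable_abs_pow_mul_exp_neg_mul_abs hδ n).const_mul C)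
      (hcont n α).aestronglyMeasurable (Eventually.of_forall (hbd n α hα))
  · refine Eventually.of_forall fun τ β _ => ?_
    have h1 : HasDerivAt (fun β : ℝ => (((Real.pi / 2 + β : ℝ) : ℂ) * τ)) (1 * τ) β := by
      refine HasDerivAt.mul_const ?_ _
      have := ((hasDerivAt_id β).const_add (Real.pi / 2)).ofReal_comp
      simpa using this
    convert! (h1.cexp.mul_const (coshPowFourier s τ)).const_mul ((τ : ℂ) ^ n) using 1
    ring

lemma integral_expMellinWeight_mul_expSin {s : ℂ} (hs : 0 < s.re) {α : ℝ} (hα : Real.sin α < 1) :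
    ∫ x in Ioi (0 : ℝ), expMellinWeight s x * expSin x α =
      Complex.Gamma s * ((1 - Real.sin α : ℝ) : ℂ) ^ (-s) := by
  have h := Complex.integral_cpow_mul_exp_neg_mul_Ioi hs (sub_pos.2 hα)
  rw [one_div, Complex.inv_cpow _ _ (by
    rw [Complex.arg_ofReal_of_nonneg (sub_pos.2 hα).le]; exact Real.pi_pos.ne), ← Complex.cpow_neg,
    mul_comm] at h
  rw [← h]
  refine setIntegral_congr_fun measurableSet_Ioi fun x _ => ?_
  simp only [expMellinWeight, expSin]
  rw [mul_assoc, ← Complex.ofReal_mul, ← Real.exp_add, Complex.ofReal_exp]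
  congr 3
  push_cast; ring

/-- Formal application of `Dⁿ` to the generalized Kontorovich–Lebedev formula, after pairing
with `e⁻ˣ xˢ⁻¹`. -/
lemma Gamma_mul_integral_pow_mul_exp_mul_coshPowFourier {s : ℂ} (hs : 0 < s.re) {a η R ρ Θ : ℝ}
    (hR : 0 < R) (hρ1 : ρ < 1)
    (hρ : ∀ α ∈ Metric.ball a η, ∀ w : ℂ, ‖w - α‖ ≤ R → (Complex.sin w).re ≤ ρ)
    (hΘ : Θ < Real.pi) (hη : ∀ α ∈ Metric.ball a η, |Real.pi / 2 + α| ≤ Θ)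
    (n : ℕ) : ∀ α ∈ Metric.ball a η,
    Complex.Gamma s * ∫ τ : ℝ, (τ : ℂ) ^ n *
        (Complex.exp ((Real.pi / 2 + α : ℝ) * τ) * coshPowFourier s τ) =
      2 * Real.pi * ∫ x in Ioi (0 : ℝ), expMellinWeight s x * iteratedDeriv n (expSin x) α := by
  induction n with
  | zero =>
    intro α hα
    have hsin : Real.sin α < 1 := by
      have := hρ α hα α (by simpa using hR.le)
      rw [← Complex.ofReal_sin, Complex.ofReal_re] at this
      linarith
    simp only [pow_zero, one_mul, iteratedDeriv_zero]
    have hθ : |Real.pi / 2 + α| < Real.pi := (hη α hα).trans_lt hΘ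
    -- Both sides meet because 1 + cos(π/2 + α) = 1 - sin α.
    rw [integral_exp_mul_coshPowFourier hs hθ, coshPow_mul_I s hθ,
      integral_expMellinWeight_mul_expSin hs hsin, add_comm (Real.pi / 2), Real.cos_add_pi_div_two,
      ← sub_eq_add_neg]
    ring
  | succ n ih =>
    intro α hα
    have h1 := (hasDerivAt_integral_pow_mul_exp_mul_coshPowFourier hs hΘ hη n hα).const_mul
      (Complex.Gamma s)
    have h2 := (hasDerivAt_integral_expMellinWeight_mul_iteratedDeriv hs hR hρ1 hρ n hα).const_mul
      (2 * Real.pi : ℂ)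
    -- The induction hypothesis holds on the whole ball, so the two sides agree near α and their
    -- derivatives coincide.
    exact h1.unique (h2.congr_of_eventuallyEq
      (eventually_of_mem (Metric.isOpen_ball.mem_nhds hα) ih))

/-! ### Summation against the Taylor coefficients. -/

/-- The terms are dominated by products u n * W x: the numerical series converges because q < R, and
the function of x is integrable because ρ < 1. -/
lemma hasSum_integral_expMellinWeight_mul {s : ℂ} (hs : 0 < s.re) {a q R ρ C₀ : ℝ} {c : ℕ → ℂ}
    (hC₀ : 0 ≤ C₀) (hq : 0 ≤ q) (hqR : q < R) (hc : ∀ n, ‖c n‖ ≤ C₀ * (q ^ n / n.factorial))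
    (hρ1 : ρ < 1) (hρ : ∀ w : ℂ, ‖w - a‖ ≤ R → (Complex.sin w).re ≤ ρ) (k : ℕ) :
    IntegrableOn (fun x => expMellinWeight s x * ∑' n, c n * iteratedDeriv (n + k) (expSin x) a)
      (Ioi 0) ∧
    HasSum (fun n => c n * ∫ x in Ioi (0 : ℝ), expMellinWeight s x *
        iteratedDeriv (n + k) (expSin x) a)
      (∫ x in Ioi (0 : ℝ), expMellinWeight s x *
        ∑' n, c n * iteratedDeriv (n + k) (expSin x) a) := by
  have hR : 0 < R := hq.trans_lt hqR
  have hsum := (summable_pow_div_factorial_mul hq hqR k).mul_left C₀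
  set u : ℕ → ℝ := fun n => C₀ * (q ^ n / n.factorial * ((n + k).factorial / R ^ (n + k))) with hu
  set W : ℝ → ℝ := fun x => x ^ (s.re - 1) * Real.exp (-(1 - ρ) * x) with hWdef
  have hW : IntegrableOn W (Ioi 0) := integrableOn_rpow_mul_exp_neg_mul hs (sub_pos.2 hρ1)
  set F : ℕ → ℝ → ℂ := fun n x => c n * (expMellinWeight s x *
    iteratedDeriv (n + k) (expSin x) a) with hF
  have hmeas : ∀ n, AEStronglyMeasurable (F n) (volume.restrict (Ioi 0)) := fun n =>
    (aestronglyMeasurable_expMellinWeight_mul_iteratedDeriv s (n + k) a).const_mul (c n)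
  have hbound : ∀ n, ∀ᵐ x ∂volume.restrict (Ioi (0 : ℝ)), ‖F n x‖ ≤ u n * W x := by
    intro n
    filter_upwards [ae_restrict_mem measurableSet_Ioi] with x hx
    rw [hF, norm_mul]
    refine (mul_le_mul (hc n) (norm_expMellinWeight_mul_iteratedDeriv_le hR hρ hx (n + k))
      (norm_nonneg _) (by positivity)).trans_eq ?_
    rw [hu]; ring
  have hlim : ∀ᵐ x ∂volume.restrict (Ioi (0 : ℝ)), HasSum (fun n => F n x)
      (expMellinWeight s x * ∑' n, c n * iteratedDeriv (n + k) (expSin x) a) := by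
    filter_upwards [ae_restrict_mem measurableSet_Ioi] with x hx
    have := (summable_opFun hC₀ hq hc (le_of_lt hx) k a).hasSum.mul_left (expMellinWeight s x)
    refine this.congr_fun fun n => ?_
    rw [hF]; ring
  constructor
  · refine Integrable.mono' (hW.const_mul (∑' n, u n)) ?_ ?_
    · exact aestronglyMeasurable_of_tendsto_ae atTop
        (f := fun (N : ℕ) x => ∑ n ∈ Finset.range N, F n x)
        (fun N => Finset.aestronglyMeasurable_fun_sum _ fun n _ => hmeas n)
        (hlim.mono fun x hx => hx.tendsto_sum_nat)
    · filter_upwards [hlim, ae_all_iff.2 hbound] with x hx hb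
      rw [← hx.tsum_eq, ← tsum_mul_right]
      exact tsum_of_norm_bounded (hsum.mul_right (W x)).hasSum hb
  · have := hasSum_integral_of_dominated_convergence (fun n x => u n * W x) hmeas hbound
      (Eventually.of_forall fun x => hsum.mul_right (W x))
      (by simp_rw [tsum_mul_right]; exact hW.const_mul _) hlim
    simpa only [hF, integral_const_mul] using this

lemma IsEntireOfExpType.exists_norm_le_exp {ψ : ℂ → ℂ} {b q : ℝ}
    (hψ : IsEntireOfExpType ψ b) (hq : b < q) :
    ∃ C : ℝ, ∀ τ : ℝ, ‖ψ τ‖ ≤ C * Real.exp (q * |τ|) := by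
  obtain ⟨C, hC⟩ := hψ.2 (q - b) (sub_pos.2 hq)
  refine ⟨C, fun τ => ?_⟩
  simpa using hC τ

lemma integrable_mul_exp_mul_coshPowFourier {s : ℂ} (hs : 0 < s.re) {ψ : ℂ → ℂ} {q θ C₀ : ℝ}
    (hψc : Continuous ψ) (hψ : ∀ τ : ℝ, ‖ψ τ‖ ≤ C₀ * Real.exp (q * |τ|))
    (hq : 0 ≤ q) (hθ : 0 ≤ θ) (hqθ : q + θ < Real.pi) (k : ℕ) :
    Integrable fun τ : ℝ => ψ τ * (τ : ℂ) ^ k *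
      (Complex.exp (θ * τ) * coshPowFourier s τ) := by
  have hC₀ : 0 ≤ C₀ := by simpa using (norm_nonneg _).trans (hψ 0)
  obtain ⟨C, hC, h⟩ := norm_coshPowFourier_le hs (θ := (q + θ + Real.pi) / 2)
    (by positivity) (by linarith)
  have hc := continuous_coshPowFourier hs
  have hδ : 0 < (Real.pi - (q + θ)) / 2 := by linarith
  have hcont : Continuous fun τ : ℝ => ψ τ * (τ : ℂ) ^ k *
      (Complex.exp (θ * τ) * coshPowFourier s τ) := by fun_prop
  refine Integrable.mono' ((integrable_abs_pow_mul_exp_neg_mul_abs hδ k).const_mul (C₀ * C))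
    hcont.aestronglyMeasurable (Eventually.of_forall fun τ => ?_)
  rw [norm_mul, norm_mul, norm_mul, norm_pow, Complex.norm_real, Real.norm_eq_abs,
    ← Complex.ofReal_mul, Complex.norm_exp, Complex.ofReal_re]
  calc ‖ψ τ‖ * |τ| ^ k * (Real.exp (θ * τ) * ‖coshPowFourier s τ‖)
      ≤ C₀ * Real.exp (q * |τ|) * |τ| ^ k * (Real.exp (θ * |τ|) *
          (C * Real.exp (-((q + θ + Real.pi) / 2) * |τ|))) := by
        have h1 : Real.exp (θ * τ) ≤ Real.exp (θ * |τ|) :=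
          Real.exp_le_exp.2 (mul_le_mul_of_nonneg_left (le_abs_self _) hθ)
        gcongr
        · exact hψ τ
        · exact h τ
    _ = C₀ * C * (|τ| ^ k * (Real.exp (q * |τ|) * Real.exp (θ * |τ|) *
          Real.exp (-((q + θ + Real.pi) / 2) * |τ|))) := by ring
    _ = _ := by rw [← Real.exp_add, ← Real.exp_add]; ring_nf

/-- The majorant ∑ C₀ (q|τ|)^n / n! sums to C₀ e^{q|τ|}, whose growth together with e^{θτ} stays
below the decay of the transform since q + θ < π. -/
lemma hasSum_integral_pow_mul_exp_mul_coshPowFourier {s : ℂ} (hs : 0 < s.re) {ψ : ℂ → ℂ}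
    {q θ C₀ : ℝ} {c : ℕ → ℂ} (hc : ∀ n, ‖c n‖ ≤ C₀ * (q ^ n / n.factorial))
    (hψ : ∀ z : ℂ, HasSum (fun n => c n * z ^ n) (ψ z))
    (hq : 0 ≤ q) (hθ : 0 ≤ θ) (hqθ : q + θ < Real.pi) (k : ℕ) :
    HasSum (fun n => c n * ∫ τ : ℝ, (τ : ℂ) ^ (n + k) *
        (Complex.exp (θ * τ) * coshPowFourier s τ))
      (∫ τ : ℝ, ψ τ * (τ : ℂ) ^ k * (Complex.exp (θ * τ) * coshPowFourier s τ)) := by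
  have hcN := continuous_coshPowFourier hs
  set g : ℝ → ℝ := fun τ => ‖(τ : ℂ) ^ k * (Complex.exp (θ * τ) * coshPowFourier s τ)‖ with hg
  have hsum : ∀ τ : ℝ, HasSum (fun n : ℕ => C₀ * (q ^ n / n.factorial) * |τ| ^ n * g τ)
      (C₀ * (Real.exp (q * |τ|) * g τ)) := by
    intro τ
    have h1 := (NormedSpace.expSeries_div_hasSum_exp (q * |τ|)).mul_right (g τ) |>.mul_left C₀
    rw [← Real.exp_eq_exp_ℝ] at h1
    refine h1.congr_fun fun n => ?_
    rw [mul_pow]; ring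
  have hint : Integrable fun τ : ℝ => C₀ * (Real.exp (q * |τ|) * g τ) := by
    -- The majorant itself plays the role of ψ, as e^{q|Re z|}; only continuity and growth on the
    -- real line are needed there.
    have := (integrable_mul_exp_mul_coshPowFourier (C₀ := 1) (q := q) hs
      (ψ := fun z => ((Real.exp (q * |z.re|) : ℝ) : ℂ)) (by fun_prop)
      (fun τ => by
        rw [Complex.norm_real, Real.norm_of_nonneg (Real.exp_pos _).le]; simp)
        hq hθ hqθ k).norm.const_mul C₀
    refine this.congr (Eventually.of_forall fun τ => ?_)
    simp only [hg]
    rw [mul_assoc, norm_mul, Complex.norm_real, Real.norm_of_nonneg (Real.exp_pos _).le]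
    simp
  have := hasSum_integral_of_dominated_convergence
    (F := fun n (τ : ℝ) => c n * ((τ : ℂ) ^ (n + k) * (Complex.exp (θ * τ) * coshPowFourier s τ)))
    (f := fun τ : ℝ => ψ τ * (τ : ℂ) ^ k * (Complex.exp (θ * τ) * coshPowFourier s τ))
    (μ := volume)
    (fun n τ => C₀ * (q ^ n / n.factorial) * |τ| ^ n * g τ)
    (fun n => (by fun_prop : Continuous _).aestronglyMeasurable) ?_
    (Eventually.of_forall fun τ => (hsum τ).summable)
    (hint.congr (Eventually.of_forall fun τ => (hsum τ).tsum_eq.symm)) ?_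
  · simpa only [integral_const_mul] using this
  · refine fun n => Eventually.of_forall fun τ => ?_
    rw [pow_add, mul_assoc ((τ : ℂ) ^ n), ← mul_assoc, norm_mul, norm_mul, norm_pow,
      Complex.norm_real, Real.norm_eq_abs]
    exact mul_le_mul_of_nonneg_right (mul_le_mul_of_nonneg_right (hc n) (by positivity))
      (norm_nonneg _)
  · refine Eventually.of_forall fun τ => ?_
    rw [mul_assoc]
    refine ((hψ τ).mul_right _).congr_fun fun n => ?_
    ring

/-! ### The Mellin pairing of Macdonald's function. -/

lemma integral_eq_integral_Ioi_add_neg {f : ℝ → ℂ} (hf : Integrable f) :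
    ∫ x, f x = ∫ x in Ioi (0 : ℝ), (f x + f (-x)) := by
  rw [integral_add hf.integrableOn hf.comp_neg.integrableOn, integral_comp_neg_Ioi, neg_zero,
    add_comm, ← setIntegral_union (Iic_disjoint_Ioi le_rfl) measurableSet_Ioi hf.integrableOn
    hf.integrableOn, Iic_union_Ioi, setIntegral_univ]

lemma norm_cosh_I_mul_mul_le (τ t : ℝ) : ‖Complex.cosh (Complex.I * τ * t)‖ ≤ 1 := by
  have : Complex.I * τ * t = ((τ * t : ℝ) : ℂ) * Complex.I := by push_cast; ring
  rw [this, Complex.cosh_mul_I, ← Complex.ofReal_cos, Complex.norm_real]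
  exact Real.abs_cos_le_one _

lemma coshPowFourier_eq {s : ℂ} (hs : 0 < s.re) (τ : ℝ) :
    coshPowFourier s τ =
      2 * ∫ t in Ioi (0 : ℝ), Complex.cosh (Complex.I * τ * t) * coshPow s t := by
  have hc := continuous_coshPow s
  have hi : Integrable fun t : ℝ => Complex.exp (Complex.I * τ * t) * coshPow s t :=
    (integrable_coshPow hs).norm.mono' (by fun_prop : Continuous fun t : ℝ =>
      Complex.exp (Complex.I * τ * t) * coshPow s t).aestronglyMeasurable
      (Eventually.of_forall fun t => by rw [norm_mul, norm_exp_I_mul_mul, one_mul])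
  rw [coshPowFourier, integral_eq_integral_Ioi_add_neg hi, ← integral_const_mul]
  congr 1
  funext t
  rw [Complex.ofReal_neg, coshPow_neg, ← mul_assoc, Complex.cosh, mul_div_cancel₀ _ two_ne_zero,
    mul_neg, add_mul]

/-- The kernel `e⁻ˣ xˢ⁻¹ exp (-x cosh t)` of the double integral for the Mellin transform. -/
noncomputable def mellinKernel (s : ℂ) (x t : ℝ) : ℂ :=
  expMellinWeight s x * Complex.exp (-(x * Real.cosh t : ℝ))

lemma mellinKernel_eq (s : ℂ) (x t : ℝ) : mellinKernel s x t =
    (x : ℂ) ^ (s - 1) * Complex.exp (-(((1 + Real.cosh t : ℝ) : ℂ) * x)) := by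
  rw [mellinKernel, expMellinWeight, Complex.ofReal_exp, mul_assoc, ← Complex.exp_add]
  congr 2
  push_cast; ring

/-- The weight and the kernel of K combine into e^{-(1 + cosh t)x}, so this is a Gamma integral;
here (1 + cosh t)^{-s} enters. -/
lemma integral_mellinKernel {s : ℂ} (hs : 0 < s.re) (t : ℝ) :
    ∫ x in Ioi (0 : ℝ), mellinKernel s x t = Complex.Gamma s * coshPow s t := by
  have hr : 0 < 1 + Real.cosh t := by positivity
  simp only [mellinKernel_eq]
  rw [Complex.integral_cpow_mul_exp_neg_mul_Ioi hs hr, coshPow_ofReal, one_div,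
    Complex.inv_cpow _ _ (by
      rw [Complex.arg_ofReal_of_nonneg hr.le]; exact Real.pi_pos.ne), ← Complex.cpow_neg, mul_comm]

lemma norm_mellinKernel {s : ℂ} {x : ℝ} (hx : 0 < x) (t : ℝ) :
    ‖mellinKernel s x t‖ = x ^ (s.re - 1) * Real.exp (-(1 + Real.cosh t) * x) := by
  rw [mellinKernel_eq, norm_mul, Complex.norm_cpow_eq_rpow_re_of_pos hx, Complex.norm_exp]
  congr 2
  rw [← Complex.ofReal_mul, ← Complex.ofReal_neg, Complex.ofReal_re, neg_mul]

lemma measurable_expMellinWeight (s : ℂ) : Measurable (expMellinWeight s) := by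
  unfold expMellinWeight
  fun_prop

/-- Integrating the norm in x first gives Γ(σ) (1 + cosh t)^{-σ} with σ = Re s, which is integrable
in t. -/
lemma integrable_mellinKernel {s : ℂ} (hs : 0 < s.re) :
    Integrable (fun p : ℝ × ℝ => mellinKernel s p.1 p.2)
      ((volume.restrict (Ioi 0)).prod (volume.restrict (Ioi 0))) := by
  have hm : Measurable fun p : ℝ × ℝ => mellinKernel s p.1 p.2 := by
    unfold mellinKernel
    have := measurable_expMellinWeight s
    fun_prop
  have hpos : ∀ t : ℝ, 0 < 1 + Real.cosh t := fun t => by positivity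
  rw [integrable_prod_iff' hm.aestronglyMeasurable]
  constructor
  · refine Eventually.of_forall fun t => ?_
    refine (integrableOn_rpow_mul_exp_neg_mul hs (hpos t)).mono'
      (hm.comp measurable_prodMk_right).aestronglyMeasurable ?_
    filter_upwards [ae_restrict_mem measurableSet_Ioi] with x hx
    exact (norm_mellinKernel hx t).le
  · have h := ((integrable_coshPow (s := (s.re : ℂ)) (by simpa using hs)).norm.const_mul
      (Real.Gamma s.re)).integrableOn (s := Ioi (0 : ℝ))
    refine h.congr (Eventually.of_forall fun t => ?_)
    have h1 : ∫ x in Ioi (0 : ℝ), ‖mellinKernel s x t‖ =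
        ∫ x in Ioi (0 : ℝ), x ^ (s.re - 1) * Real.exp (-((1 + Real.cosh t) * x)) :=
      setIntegral_congr_fun measurableSet_Ioi fun x hx => by
        simp only [norm_mellinKernel (mem_Ioi.1 hx) t, neg_mul]
    simp only [h1]
    rw [Real.integral_rpow_mul_exp_neg_mul_Ioi hs (hpos t), coshPow_ofReal,
      Complex.norm_cpow_eq_rpow_re_of_pos (hpos t), one_div, Real.inv_rpow (hpos t).le,
      ← Real.rpow_neg (hpos t).le, mul_comm]
    simp

/-- Fubini's theorem for the Mellin transform of an integral over the order of Macdonald's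
function. -/
lemma integral_expMellinWeight_mul_integral_macdonaldK {s : ℂ} (hs : 0 < s.re) {A : ℝ → ℂ}
    (hA : IntegrableOn A (Ioi 0)) :
    IntegrableOn (fun x => expMellinWeight s x *
      ∫ τ in Ioi (0 : ℝ), A τ * macdonaldK (Complex.I * τ) x) (Ioi 0) ∧
    ∫ x in Ioi (0 : ℝ), expMellinWeight s x *
        ∫ τ in Ioi (0 : ℝ), A τ * macdonaldK (Complex.I * τ) x =
      ∫ τ in Ioi (0 : ℝ), A τ * (Complex.Gamma s / 2 * coshPowFourier s τ) := by
  set μ : Measure ℝ := volume.restrict (Ioi 0) with hμ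
  have hG := integrable_mellinKernel hs
  rw [← hμ] at hG
  -- The factor cosh(iτt) = cos(τt) is bounded by 1, so the triple integral converges absolutely as
  -- a product.
  have h3 : Integrable (fun p : ℝ × ℝ × ℝ => A p.1 * mellinKernel s p.2.1 p.2.2 *
      Complex.cosh (Complex.I * p.1 * p.2.2)) (μ.prod (μ.prod μ)) := by
    refine (Integrable.mul_prod hA hG).mul_bdd (c := 1) ?_ ?_
    · exact (by fun_prop : Continuous fun p : ℝ × ℝ × ℝ =>
        Complex.cosh (Complex.I * p.1 * p.2.2)).aestronglyMeasurable
    · exact Eventually.of_forall fun p => norm_cosh_I_mul_mul_le _ _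
  have h4 := ((measurePreserving_prodAssoc μ μ μ).integrable_comp_of_integrable h3).integral_prod_left
  have hΦ : ∀ τ x : ℝ, ∫ t, A τ * mellinKernel s x t * Complex.cosh (Complex.I * τ * t) ∂μ =
      expMellinWeight s x * (A τ * macdonaldK (Complex.I * τ) x) := by
    intro τ x
    rw [macdonaldK, ← integral_const_mul, ← integral_const_mul]
    congr 1
    funext t
    rw [mellinKernel]; ring
  have h5 : Integrable (fun p : ℝ × ℝ => expMellinWeight s p.2 *
      (A p.1 * macdonaldK (Complex.I * p.1) p.2)) (μ.prod μ) := by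
    refine h4.congr (Eventually.of_forall fun p => ?_)
    exact hΦ p.1 p.2
  refine ⟨?_, ?_⟩
  · have := h5.integral_prod_right
    simp only [integral_const_mul] at this
    exact this
  · have hswap := integral_integral_swap (f := fun τ x => expMellinWeight s x *
      (A τ * macdonaldK (Complex.I * τ) x)) h5
    simp only [← integral_const_mul]
    rw [← hswap]
    congr 1
    funext τ
    have h6 : Integrable (fun p : ℝ × ℝ => mellinKernel s p.1 p.2 *
        Complex.cosh (Complex.I * τ * p.2)) (μ.prod μ) := by
      refine hG.mul_bdd (c := 1) ?_ ?_
      · exact (by fun_prop : Continuous fun p : ℝ × ℝ =>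
          Complex.cosh (Complex.I * τ * p.2)).aestronglyMeasurable
      · exact Eventually.of_forall fun p => norm_cosh_I_mul_mul_le _ _
    calc ∫ x, expMellinWeight s x * (A τ * macdonaldK (Complex.I * τ) x) ∂μ
        = ∫ x, A τ * ∫ t, mellinKernel s x t * Complex.cosh (Complex.I * τ * t) ∂μ ∂μ := by
          congr 1
          funext x
          rw [← hΦ, ← integral_const_mul]
          simp only [mul_assoc]
      _ = A τ * ∫ t, ∫ x, mellinKernel s x t * Complex.cosh (Complex.I * τ * t) ∂μ ∂μ := by
          rw [integral_const_mul, integral_integral_swap h6]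
      _ = A τ * ∫ t, Complex.Gamma s * (Complex.cosh (Complex.I * τ * t) * coshPow s t) ∂μ := by
          congr 2
          funext t
          rw [integral_mul_const, integral_mellinKernel hs]
          ring
      _ = _ := by
          rw [integral_const_mul, coshPowFourier_eq hs]
          ring

/-! ### Absolute convergence of the regularized integral. -/

lemma integrableOn_exp_neg_mul_cosh {x : ℝ} (hx : 0 < x) :
    IntegrableOn (fun t : ℝ => Real.exp (-(x * Real.cosh t))) (Ioi 0) := by
  refine (exp_neg_integrableOn_Ioi 0 hx).mono'
    (by fun_prop : Continuous fun t : ℝ => Real.exp (-(x * Real.cosh t))).aestronglyMeasurable ?_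
  filter_upwards [ae_restrict_mem measurableSet_Ioi] with t ht
  rw [Real.norm_of_nonneg (Real.exp_pos _).le, Real.exp_le_exp, neg_mul, neg_le_neg_iff]
  have h1 := Real.self_le_sinh_iff.2 (le_of_lt ht)
  have h2 := Real.sinh_lt_cosh t
  exact mul_le_mul_of_nonneg_left (by linarith) hx.le

lemma norm_macdonaldK_integrand_le (τ x t : ℝ) :
    ‖Complex.exp (-(x * Real.cosh t : ℝ)) * Complex.cosh (Complex.I * τ * t)‖ ≤
      Real.exp (-(x * Real.cosh t)) := by
  rw [norm_mul, Complex.norm_exp, ← Complex.ofReal_neg, Complex.ofReal_re]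
  exact mul_le_of_le_one_right (Real.exp_pos _).le (norm_cosh_I_mul_mul_le τ t)

lemma norm_macdonaldK_le {x : ℝ} (hx : 0 < x) (τ : ℝ) :
    ‖macdonaldK (Complex.I * τ) x‖ ≤ ∫ t in Ioi (0 : ℝ), Real.exp (-(x * Real.cosh t)) :=
  norm_integral_le_of_norm_le (integrableOn_exp_neg_mul_cosh hx)
    (Eventually.of_forall fun t => norm_macdonaldK_integrand_le τ x t)

lemma continuous_macdonaldK {x : ℝ} (hx : 0 < x) :
    Continuous fun τ : ℝ => macdonaldK (Complex.I * τ) x := by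
  unfold macdonaldK
  refine continuous_of_dominated (bound := fun t => Real.exp (-(x * Real.cosh t))) (fun τ => ?_)
    (fun τ => Eventually.of_forall fun t => norm_macdonaldK_integrand_le τ x t)
    (integrableOn_exp_neg_mul_cosh hx) (Eventually.of_forall fun t => by fun_prop)
  exact (by fun_prop : Continuous fun t : ℝ => Complex.exp (-(x * Real.cosh t : ℝ)) *
    Complex.cosh (Complex.I * τ * t)).aestronglyMeasurable

/-- The factor of the Kontorovich–Lebedev integrand that does not depend on `x`, without the
Gaussian regularization. -/
noncomputable def klDensity (ψ₁ ψ₂ : ℂ → ℂ) (θ τ : ℝ) : ℂ :=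
  ψ₁ τ * (Real.cosh (θ * τ) : ℂ) + ψ₂ τ * (τ : ℂ) * (Real.sinh (θ * τ) : ℂ)

lemma continuous_klDensity {ψ₁ ψ₂ : ℂ → ℂ} (h₁ : Continuous ψ₁) (h₂ : Continuous ψ₂) (θ : ℝ) :
    Continuous (klDensity ψ₁ ψ₂ θ) := by
  unfold klDensity
  fun_prop

lemma norm_klDensity_le {ψ₁ ψ₂ : ℂ → ℂ} {q θ C₁ C₂ : ℝ}
    (h₁ : ∀ τ : ℝ, ‖ψ₁ τ‖ ≤ C₁ * Real.exp (q * |τ|))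
    (h₂ : ∀ τ : ℝ, ‖ψ₂ τ‖ ≤ C₂ * Real.exp (q * |τ|)) (τ : ℝ) :
    ‖klDensity ψ₁ ψ₂ θ τ‖ ≤ (C₁ + C₂ * |τ|) * Real.exp ((q + |θ|) * |τ|) := by
  have hc : |Real.cosh (θ * τ)| ≤ Real.exp (|θ| * |τ|) := by
    rw [abs_of_pos (Real.cosh_pos _), ← Real.cosh_abs, abs_mul, Real.cosh_eq]
    have : Real.exp (-(|θ| * |τ|)) ≤ Real.exp (|θ| * |τ|) :=
      Real.exp_le_exp.2 (by linarith [mul_nonneg (abs_nonneg θ) (abs_nonneg τ)])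
    linarith
  have hs : |Real.sinh (θ * τ)| ≤ Real.exp (|θ| * |τ|) := by
    refine le_trans ?_ hc
    rw [Real.abs_sinh, ← Real.cosh_abs, abs_of_pos (Real.cosh_pos _)]
    exact (Real.sinh_lt_cosh _).le
  have hC₁ : 0 ≤ C₁ * Real.exp (q * |τ|) := (norm_nonneg _).trans (h₁ τ)
  have hC₂ : 0 ≤ C₂ * Real.exp (q * |τ|) := (norm_nonneg _).trans (h₂ τ)
  refine (norm_add_le _ _).trans ?_
  rw [norm_mul, norm_mul, norm_mul, Complex.norm_real, Complex.norm_real, Complex.norm_real,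
    Real.norm_eq_abs, Real.norm_eq_abs, Real.norm_eq_abs]
  calc ‖ψ₁ τ‖ * |Real.cosh (θ * τ)| + ‖ψ₂ τ‖ * |τ| * |Real.sinh (θ * τ)|
      ≤ C₁ * Real.exp (q * |τ|) * Real.exp (|θ| * |τ|) +
          C₂ * Real.exp (q * |τ|) * |τ| * Real.exp (|θ| * |τ|) := by
        gcongr
        · exact h₁ τ
        · exact h₂ τ
    _ = _ := by rw [add_mul q, Real.exp_add]; ring

lemma integrable_exp_neg_mul_sq_mul_klDensity {ψ₁ ψ₂ : ℂ → ℂ} {q C₁ C₂ : ℝ}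
    (hc₁ : Continuous ψ₁) (hc₂ : Continuous ψ₂)
    (h₁ : ∀ τ : ℝ, ‖ψ₁ τ‖ ≤ C₁ * Real.exp (q * |τ|))
    (h₂ : ∀ τ : ℝ, ‖ψ₂ τ‖ ≤ C₂ * Real.exp (q * |τ|)) {ε : ℝ} (hε : 0 < ε) (θ : ℝ) :
    Integrable fun τ : ℝ => (Real.exp (-ε * τ ^ 2) : ℂ) * klDensity ψ₁ ψ₂ θ τ := by
  have hc := continuous_klDensity hc₁ hc₂ θ
  set L := q + |θ|
  set K := Real.exp ((L + 1) ^ 2 / (4 * ε))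
  have hi := (((integrable_abs_pow_mul_exp_neg_mul_abs one_pos 0).const_mul C₁).add
    ((integrable_abs_pow_mul_exp_neg_mul_abs one_pos 1).const_mul C₂)).const_mul K
  refine hi.mono' (by fun_prop : Continuous fun τ : ℝ =>
    (Real.exp (-ε * τ ^ 2) : ℂ) * klDensity ψ₁ ψ₂ θ τ).aestronglyMeasurable
    (Eventually.of_forall fun τ => ?_)
  have hn := norm_klDensity_le (θ := θ) h₁ h₂ τ
  have hpos : 0 ≤ C₁ + C₂ * |τ| :=
    nonneg_of_mul_nonneg_left ((norm_nonneg _).trans hn) (Real.exp_pos _)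
  rw [norm_mul, Complex.norm_real, Real.norm_of_nonneg (Real.exp_pos _).le]
  have hexp : Real.exp (-ε * τ ^ 2) * Real.exp (L * |τ|) ≤ K * Real.exp (-1 * |τ|) := by
    rw [← Real.exp_add, ← Real.exp_add, Real.exp_le_exp]
    -- Completing the square in (L + 1)|τ| - ε τ² produces the constant `K`.
    have h4 : 0 ≤ (L + 1 - 2 * ε * |τ|) ^ 2 / (4 * ε) := by positivity
    have h5 : (L + 1 - 2 * ε * |τ|) ^ 2 / (4 * ε) =
        (L + 1) ^ 2 / (4 * ε) - (L + 1) * |τ| + ε * |τ| ^ 2 := by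
      field_simp; ring
    rw [sq_abs] at h5
    linarith
  calc Real.exp (-ε * τ ^ 2) * ‖klDensity ψ₁ ψ₂ θ τ‖
      ≤ Real.exp (-ε * τ ^ 2) * ((C₁ + C₂ * |τ|) * Real.exp (L * |τ|)) := by gcongr
    _ = (C₁ + C₂ * |τ|) * (Real.exp (-ε * τ ^ 2) * Real.exp (L * |τ|)) := by ring
    _ ≤ (C₁ + C₂ * |τ|) * (K * Real.exp (-1 * |τ|)) := by gcongr
    _ = _ := by simp only [Pi.add_apply]; ring

lemma integrableOn_klIntegrand {ψ₁ ψ₂ : ℂ → ℂ} {ε x a : ℝ}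
    (h : Integrable fun τ : ℝ => (Real.exp (-ε * τ ^ 2) : ℂ) *
      klDensity ψ₁ ψ₂ (Real.pi / 2 + a) τ) (hx : 0 < x) :
    IntegrableOn (klIntegrand ψ₁ ψ₂ ε x a) (Ioi 0) :=
  (h.mul_bdd (continuous_macdonaldK hx).aestronglyMeasurable
    (Eventually.of_forall (norm_macdonaldK_le hx))).integrableOn

/-! ### Symmetrization, removal of the Gaussian, and the main theorem. -/

/-- For even `ψ₁`, `ψ₂`, symmetrization turns the exponential into hyperbolic functions. -/
lemma integral_klDensity_mul_coshPowFourier {s : ℂ} {ψ₁ ψ₂ : ℂ → ℂ} {θ : ℝ}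
    (heven₁ : Function.Even ψ₁) (heven₂ : Function.Even ψ₂)
    (h₁ : Integrable fun τ : ℝ => ψ₁ τ * (τ : ℂ) ^ 0 *
      (Complex.exp (θ * τ) * coshPowFourier s τ))
    (h₂ : Integrable fun τ : ℝ => ψ₂ τ * (τ : ℂ) ^ 1 *
      (Complex.exp (θ * τ) * coshPowFourier s τ)) :
    Integrable (fun τ : ℝ => klDensity ψ₁ ψ₂ θ τ * coshPowFourier s τ) ∧
    2 * ∫ τ in Ioi (0 : ℝ), klDensity ψ₁ ψ₂ θ τ * coshPowFourier s τ =
      (∫ τ : ℝ, ψ₁ τ * (τ : ℂ) ^ 0 * (Complex.exp (θ * τ) * coshPowFourier s τ)) +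
      ∫ τ : ℝ, ψ₂ τ * (τ : ℂ) ^ 1 * (Complex.exp (θ * τ) * coshPowFourier s τ) := by
  have key : ∀ τ : ℝ, (ψ₁ τ * (τ : ℂ) ^ 0 * (Complex.exp (θ * τ) * coshPowFourier s τ) +
      ψ₂ τ * (τ : ℂ) ^ 1 * (Complex.exp (θ * τ) * coshPowFourier s τ)) +
      (ψ₁ (-τ : ℝ) * ((-τ : ℝ) : ℂ) ^ 0 *
        (Complex.exp (θ * (-τ : ℝ)) * coshPowFourier s (-τ)) +
      ψ₂ (-τ : ℝ) * ((-τ : ℝ) : ℂ) ^ 1 *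
        (Complex.exp (θ * (-τ : ℝ)) * coshPowFourier s (-τ))) =
      2 * (klDensity ψ₁ ψ₂ θ τ * coshPowFourier s τ) := by
    intro τ
    rw [coshPowFourier_neg, klDensity, Complex.ofReal_neg, heven₁ (τ : ℂ), heven₂ (τ : ℂ)]
    push_cast
    rw [Complex.cosh, Complex.sinh, mul_neg]
    ring
  have h := h₁.add h₂
  constructor
  · refine ((h.add h.comp_neg).const_mul (1 / 2)).congr (Eventually.of_forall fun τ => ?_)
    have := key τ
    simp only [Pi.add_apply]
    rw [this]; ring
  · rw [← integral_add h₁ h₂, ← integral_const_mul]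
    refine ((integral_eq_integral_Ioi_add_neg h).trans ?_).symm
    congr 1
    funext τ
    exact key τ

lemma tendsto_integral_exp_neg_mul_sq_mul {f : ℝ → ℂ} {μ : Measure ℝ} (hf : Integrable f μ) :
    Tendsto (fun ε : ℝ => ∫ τ, (Real.exp (-ε * τ ^ 2) : ℂ) * f τ ∂μ) (𝓝[>] 0)
      (𝓝 (∫ τ, f τ ∂μ)) := by
  refine tendsto_integral_filter_of_dominated_convergence (fun τ => ‖f τ‖) ?_ ?_ hf.norm ?_
  · exact Eventually.of_forall fun ε => (by fun_prop : Continuous fun τ : ℝ =>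
      (Real.exp (-ε * τ ^ 2) : ℂ)).aestronglyMeasurable.mul hf.aestronglyMeasurable
  · filter_upwards [self_mem_nhdsWithin] with ε hε
    refine Eventually.of_forall fun τ => ?_
    rw [norm_mul, Complex.norm_real, Real.norm_of_nonneg (Real.exp_pos _).le]
    refine mul_le_of_le_one_left (norm_nonneg _) (Real.exp_le_one_iff.2 ?_)
    have : 0 ≤ ε * τ ^ 2 := mul_nonneg (le_of_lt hε) (sq_nonneg τ)
    linarith
  · refine Eventually.of_forall fun τ => ?_
    have hc : Continuous fun ε : ℝ => (Real.exp (-ε * τ ^ 2) : ℂ) * f τ := by fun_prop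
    simpa using (hc.tendsto 0).mono_left nhdsWithin_le_nhds

lemma mellin_exp_neg_mul_eq (f : ℝ → ℂ) (s : ℂ) :
    mellin (fun x : ℝ => (Real.exp (-x) : ℂ) * f x) s =
      ∫ x in Ioi (0 : ℝ), expMellinWeight s x * f x := by
  simp only [mellin, expMellinWeight, smul_eq_mul, mul_assoc]

lemma mellinConvergent_exp_neg_mul_iff {f : ℝ → ℂ} {s : ℂ} :
    MellinConvergent (fun x : ℝ => (Real.exp (-x) : ℂ) * f x) s ↔
      IntegrableOn (fun x => expMellinWeight s x * f x) (Ioi 0) := by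
  simp only [MellinConvergent, expMellinWeight, smul_eq_mul, mul_assoc]

theorem theorem3 (a : ℝ) (ha : a ∈ Set.Ico (0 : ℝ) (Real.pi / 2))
    (ψ₁ ψ₂ : ℂ → ℂ) (b₁ b₂ : ℝ)
    (hb₁ : b₁ ∈ Set.Ico (0 : ℝ) ((1 - Real.sin a) / (2 * Real.exp 1)))
    (hb₂ : b₂ ∈ Set.Ico (0 : ℝ) ((1 - Real.sin a) / (2 * Real.exp 1)))
    (hψ₁ : IsEntireOfExpType ψ₁ b₁) (hψ₂ : IsEntireOfExpType ψ₂ b₂)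
    (heven₁ : Function.Even ψ₁) (heven₂ : Function.Even ψ₂) :
    -- the regularized integrals converge absolutely
    (∀ ε : ℝ, 0 < ε → ∀ x : ℝ, 0 < x →
      MeasureTheory.IntegrableOn (klIntegrand ψ₁ ψ₂ ε x a) (Set.Ioi (0 : ℝ))) ∧
    -- the two differential operators of infinite order are well defined on `exp (x sin ·)`,
    -- and `D_a ψ₂(D_a)` is also given by the termwise differentiated series
    (∀ x : ℝ, 0 < x →
      (∀ α : ℝ, Summable fun n : ℕ => taylorCoeffZero ψ₁ n * iteratedDeriv n (expSin x) α) ∧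
      (∀ α : ℝ, Summable fun n : ℕ => taylorCoeffZero ψ₂ n * iteratedDeriv n (expSin x) α) ∧
      (Summable fun n : ℕ => taylorCoeffZero ψ₂ n * iteratedDeriv (n + 1) (expSin x) a) ∧
      HasDerivAt (opFun ψ₂ (expSin x))
        (∑' n : ℕ, taylorCoeffZero ψ₂ n * iteratedDeriv (n + 1) (expSin x) a) a) ∧
    -- weak convergence: pairing with `exp (-x) * x ^ (s - 1)` on `(0, ∞)`
    (∀ s : ℂ, 0 < s.re →
      (∀ ε : ℝ, 0 < ε → MellinConvergent
        (fun x : ℝ => (Real.exp (-x) : ℂ) * klRegularized ψ₁ ψ₂ ε x a) s) ∧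
      MellinConvergent (fun x : ℝ => (Real.exp (-x) : ℂ) * klValue ψ₁ ψ₂ x a) s ∧
      Filter.Tendsto
        (fun ε : ℝ => mellin (fun x : ℝ => (Real.exp (-x) : ℂ) * klRegularized ψ₁ ψ₂ ε x a) s)
        (nhdsWithin 0 (Set.Ioi 0))
        (nhds (mellin (fun x : ℝ => (Real.exp (-x) : ℂ) * klValue ψ₁ ψ₂ x a) s))) := by
  have he : 0 < Real.exp 1 := Real.exp_pos 1
  obtain ⟨ha0, ha1⟩ := ha
  -- With half of the gap 1 - sin a, ρ = sin a + R₀ stays below 1, and the bounds on b_j say exactly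
  -- that e·b_j < R₀. Nonnegativity of sin a gives R₀ ≤ 1/2, as the local bound on Re sin requires.
  set R₀ := (1 - Real.sin a) / 2 with hR₀
  have hsin0 : 0 ≤ Real.sin a := Real.sin_nonneg_of_nonneg_of_le_pi ha0 (by linarith)
  -- Sine being 1-Lipschitz, R₀ is at most half of π/2 - a; this keeps π/2 + a + R₀ and q + π/2 + a
  -- below π.
  have hsin1 : 1 - Real.sin a ≤ Real.pi / 2 - a := by
    have h := Real.abs_sin_sub_sin_le (Real.pi / 2) a
    rw [Real.sin_pi_div_two, abs_of_pos (sub_pos.2 ha1)] at h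
    exact (le_abs_self _).trans h
  have hlt : ∀ b ∈ Set.Ico (0 : ℝ) ((1 - Real.sin a) / (2 * Real.exp 1)),
      Real.exp 1 * b < R₀ := by
    intro b hb
    have := hb.2
    rw [lt_div_iff₀ (by positivity)] at this
    rw [hR₀]; linarith
  obtain ⟨q, hqm, hqR₀⟩ := exists_between (max_lt (hlt b₁ hb₁) (hlt b₂ hb₂))
  have hq₁ : Real.exp 1 * b₁ < q := (le_max_left _ _).trans_lt hqm
  have hq₂ : Real.exp 1 * b₂ < q := (le_max_right _ _).trans_lt hqm
  have hq0 : 0 < q := (mul_nonneg he.le hb₁.1).trans_lt hq₁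
  -- The inequality q < R makes the series converge; R < R₀ leaves a ball of centres α of radius R₀
  -- - R on which the estimates are uniform.
  obtain ⟨R, hqR, hRR₀⟩ := exists_between hqR₀
  have hlb : ∀ b : ℝ, 0 ≤ b → Real.exp 1 * b < q → b < q := fun b hb h =>
    (le_mul_of_one_le_left hb (Real.one_le_exp zero_le_one)).trans_lt h
  obtain ⟨K₁, hK₁, hcoeff₁⟩ := hψ₁.exists_norm_taylorCoeffZero_le hb₁.1 hq₁
  obtain ⟨K₂, hK₂, hcoeff₂⟩ := hψ₂.exists_norm_taylorCoeffZero_le hb₂.1 hq₂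
  obtain ⟨C₁, hgrow₁⟩ := hψ₁.exists_norm_le_exp (hlb b₁ hb₁.1 hq₁)
  obtain ⟨C₂, hgrow₂⟩ := hψ₂.exists_norm_le_exp (hlb b₂ hb₂.1 hq₂)
  have hA := fun (ε : ℝ) (hε : 0 < ε) => integrable_exp_neg_mul_sq_mul_klDensity
    hψ₁.1.continuous hψ₂.1.continuous hgrow₁ hgrow₂ hε (Real.pi / 2 + a)
  refine ⟨fun ε hε x hx => integrableOn_klIntegrand (hA ε hε) hx, fun x hx =>
    ⟨summable_opFun hK₁ hq0.le hcoeff₁ hx.le 0, summable_opFun hK₂ hq0.le hcoeff₂ hx.le 0,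
      summable_opFun hK₂ hq0.le hcoeff₂ hx.le 1 a, hasDerivAt_opFun hK₂ hq0.le hcoeff₂ hx.le a⟩,
    fun s hs => ?_⟩
  have hθ0 : 0 ≤ Real.pi / 2 + a := by positivity
  have hqθ : q + (Real.pi / 2 + a) < Real.pi := by linarith
  have hρ : ∀ α ∈ Metric.ball a (R₀ - R), ∀ w : ℂ, ‖w - α‖ ≤ R →
      (Complex.sin w).re ≤ Real.sin a + R₀ := by
    intro α hα w hw
    refine re_sin_le_of_norm_sub_le (by linarith) ?_
    have h1 : ‖(α : ℂ) - a‖ < R₀ - R := by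
      rw [← Complex.ofReal_sub, Complex.norm_real]; exact hα
    have := norm_sub_le_norm_sub_add_norm_sub w α a
    linarith
  have hρ1 : Real.sin a + R₀ < 1 := by linarith
  have hη : ∀ α ∈ Metric.ball a (R₀ - R), |Real.pi / 2 + α| ≤ Real.pi / 2 + a + R₀ := by
    intro α hα
    have := abs_lt.1 (Real.dist_eq α a ▸ Metric.mem_ball.1 hα)
    rw [abs_le]
    constructor <;> linarith
  have haball : a ∈ Metric.ball a (R₀ - R) := Metric.mem_ball_self (sub_pos.2 hRR₀)
  have hmoment := fun n => Gamma_mul_integral_pow_mul_exp_mul_coshPowFourier hs (hq0.trans hqR)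
    hρ1 hρ (by linarith) hη n a haball
  obtain ⟨hint₁, hsum₁⟩ := hasSum_integral_expMellinWeight_mul hs hK₁ hq0.le hqR hcoeff₁ hρ1
    (hρ a haball) 0
  obtain ⟨hint₂, hsum₂⟩ := hasSum_integral_expMellinWeight_mul hs hK₂ hq0.le hqR hcoeff₂ hρ1
    (hρ a haball) 1
  have hsum₁' := hasSum_integral_pow_mul_exp_mul_coshPowFourier hs hcoeff₁
    (hasSum_taylorCoeffZero hψ₁.1) hq0.le hθ0 hqθ 0
  have hsum₂' := hasSum_integral_pow_mul_exp_mul_coshPowFourier hs hcoeff₂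
    (hasSum_taylorCoeffZero hψ₂.1) hq0.le hθ0 hqθ 1
  -- The two series agree term by term by the moment identity, hence so do their sums.
  have heq₁ := (hsum₁'.mul_left (Complex.Gamma s)).unique
    ((hsum₁.mul_left (2 * Real.pi : ℂ)).congr_fun fun n => by
      rw [mul_left_comm, hmoment, mul_left_comm])
  have heq₂ := (hsum₂'.mul_left (Complex.Gamma s)).unique
    ((hsum₂.mul_left (2 * Real.pi : ℂ)).congr_fun fun n => by
      rw [mul_left_comm, hmoment, mul_left_comm])
  obtain ⟨hNint, hNeq⟩ := integral_klDensity_mul_coshPowFourier heven₁ heven₂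
    (integrable_mul_exp_mul_coshPowFourier hs hψ₁.1.continuous hgrow₁ hq0.le hθ0 hqθ 0)
    (integrable_mul_exp_mul_coshPowFourier hs hψ₂.1.continuous hgrow₂ hq0.le hθ0 hqθ 1)
  have hvalue : EqOn (fun x => expMellinWeight s x * klValue ψ₁ ψ₂ x a)
      (fun x => (Real.pi / 2 : ℂ) * (expMellinWeight s x *
          (∑' n : ℕ, taylorCoeffZero ψ₁ n * iteratedDeriv (n + 0) (expSin x) a) +
        expMellinWeight s x *
          ∑' n : ℕ, taylorCoeffZero ψ₂ n * iteratedDeriv (n + 1) (expSin x) a)) (Ioi 0) := by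
    intro x hx
    simp only
    rw [klValue_eq hK₂ hq0.le hcoeff₂ (le_of_lt hx)]
    ring
  refine ⟨fun ε hε => ?_, ?_, ?_⟩
  · exact mellinConvergent_exp_neg_mul_iff.2
      (integral_expMellinWeight_mul_integral_macdonaldK hs (hA ε hε).integrableOn).1
  · exact mellinConvergent_exp_neg_mul_iff.2
      (IntegrableOn.congr_fun ((hint₁.add hint₂).const_mul (Real.pi / 2 : ℂ)) hvalue.symm
        measurableSet_Ioi)
  · have hlim := tendsto_integral_exp_neg_mul_sq_mul
      ((hNint.integrableOn (s := Ioi 0)).const_mul (Complex.Gamma s / 2))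
    have hval : ∫ τ in Ioi (0 : ℝ), Complex.Gamma s / 2 *
          (klDensity ψ₁ ψ₂ (Real.pi / 2 + a) τ * coshPowFourier s τ) =
        mellin (fun x : ℝ => (Real.exp (-x) : ℂ) * klValue ψ₁ ψ₂ x a) s := by
      rw [mellin_exp_neg_mul_eq, setIntegral_congr_fun measurableSet_Ioi hvalue,
        integral_const_mul, integral_const_mul, integral_add hint₁ hint₂]
      -- The factor 1/4 is 1/2 from the pairing of K times 1/2 from symmetrization; multiplied by
      -- the 2π of Fourier inversion it gives π/2.
      linear_combination (Complex.Gamma s / 4) * hNeq + heq₁ / 4 + heq₂ / 4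
    rw [hval] at hlim
    refine hlim.congr' ?_
    filter_upwards [self_mem_nhdsWithin] with ε hε
    rw [mellin_exp_neg_mul_eq]
    refine Eq.trans ?_
      (integral_expMellinWeight_mul_integral_macdonaldK hs (hA ε hε).integrableOn).2.symm
    congr 1
    funext τ
    ring
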